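/- Let $(X,\mu)$ be a $\sigma$-finite measure space, $V$ a separable complex Hilbert space, $\mathcal H=L^2(X,\mu;V)$, and let $A$ be a (possibly unbounded) self-adjoint operator on $\mathcal H$ with spectral projections $\Pi_\lambda=\Pi_{(-\infty,\lambda)}(A)$. Write $\tau$ for the trace of positive operators, with values in $[0,+\infty]$, and $\|\cdot\|_\infty$ for the operator norm on $\mathcal H$. For a bounded positive operator $P$ on $\mathcal H$ let $\nu_P$ be the measure $\nu_P(\Omega)=\tau(P^{1/2}\chi_\Omega P^{1/2})=\tau(\chi_\Omega P\chi_\Omega)$ on $X$, and $D\nu_P=d\nu_P/d\mu:X\to[0,+\infty]$ its density. Put $F_\Omega(\lambda)=\nu_{\Pi_\lambda}(\Omega)$ (spectral measure of a measurable set $\Omega$) and $F_x(\lambda)=D\nu_{\Pi_\lambda}(x)$ (spectral density, taken in the version that is increasing and left continuous in $\lambda$ for each $x$). For an increasing function $F:\mathbb R\to[0,+\infty]$ and $y\ge 0$ put $$F^{-1}(y)=\sup\{\lambda\in\mathbb R : F(\lambda)\le y\}\in[-\infty,+\infty],\qquad \varphi_t^F(y)=\int_0^yF^{-1}(t^2u)\,du,\qquad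 \psi^F(y)=\int_0^1\varphi_t^F(y)\,dt ,$$ and $\psi_\Omega=\psi^{F_\Omega}$, $\psi_x=\psi^{F_x}$. Integrals and sums of extended-real quantities whose positive part has finite integral (sum) are taken in $[-\infty,+\infty)$. Let $\rho\neq 0$ be a state, i.e. a positive trace class operator on $\mathcal H$, such that $\mathcal E^+(\rho)=\tau(\rho^{1/2}\max(A,0)\rho^{1/2})$ is finite, and let $\mathcal E(\rho)=\tau(\rho A)=\mathcal E^+(\rho)-\tau(\rho^{1/2}\max(-A,0)\rho^{1/2})\in[-\infty,+\infty)$ be its energy. Let $(\Omega_i)$ be a countable measurable partition of $X$. (1) The sums and integrals below, including the ones that define $\psi_{\Omega_i}$ and (for almost every $x$) $\psi_x$ at the points considered, have a finite positive part, and $$H_{\Omega_i}(\rho):=\|\rho\|_\infty\sum_i\psi_{\Omega_i}\Bigl(\frac{\nu_\rho(\Omega_i)}{\|\rho\|_\infty}\Bigr)\;\le\; H(\rho):=\|\rho\|_\infty\int_X\psi_x\Bigl(\frac{D\nu_\rho(x)}{\|\rho\|_\infty}\Bigr)d\mu(x)\;\le\;\mathcal E(\rho).$$ (2) If $(\Omega'_j)$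 is a countable measurable partition of $X$ finer than $(\Omega_i)$, i.e. each $\Omega'_j$ is contained in some $\Omega_i$, then $H_{\Omega_i}(\rho)\le H_{\Omega'_j}(\rho)$. -/

import Mathlib

open MeasureTheory Set
open scoped ENNReal InnerProductSpace

noncomputable section

namespace BalancedLT

/-! ### Extended-real integrals and sums -/

/-- The integral `∫ f⁺ - ∫ f⁻ ∈ [-∞, +∞]` of an extended-real function; it is the usual integral,
with values in `[-∞, +∞)`, as soon as `∫ f⁺ < ∞`. -/
def eint {α : Type*} [MeasurableSpace α] (μ : Measure α) (f : α → EReal) : EReal :=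
  ((∫⁻ a, (f a).toENNReal ∂μ : ℝ≥0∞) : EReal) - ((∫⁻ a, (-f a).toENNReal ∂μ : ℝ≥0∞) : EReal)

/-- The sum `∑ f⁺ - ∑ f⁻ ∈ [-∞, +∞]` of a family of extended reals. -/
def esum {ι : Type*} (f : ι → EReal) : EReal :=
  ((∑' i, (f i).toENNReal : ℝ≥0∞) : EReal) - ((∑' i, (-f i).toENNReal : ℝ≥0∞) : EReal)

/-! ### The pseudo-inverse and the functions `φ_t` and `ψ` of an increasing function `F` -/

/-- `F⁻¹(y) = sup {x ∈ ℝ | F x ≤ y} ∈ [-∞, +∞]`. -/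
def pinv (F : ℝ → ℝ≥0∞) (y : ℝ) : EReal :=
  sSup {z : EReal | ∃ x : ℝ, F x ≤ ENNReal.ofReal y ∧ z = (x : EReal)}

/-- `φ_t(y) = ∫_0^y F⁻¹(t² u) du`. -/
def phi (F : ℝ → ℝ≥0∞) (t y : ℝ) : EReal :=
  eint (volume.restrict (Ioc 0 y)) fun u => pinv F (t ^ 2 * u)

/-- `ψ(y) = ∫_0^1 φ_t(y) dt`. -/
def psi (F : ℝ → ℝ≥0∞) (y : ℝ) : EReal :=
  eint (volume.restrict (Ioc 0 1)) fun t => phi F t y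

/-- The positive part `∫_0^1 ∫_0^y max (F⁻¹(t² u), 0) du dt` of the double integral in `ψ(y)`. -/
def psiPosPart (F : ℝ → ℝ≥0∞) (y : ℝ) : ℝ≥0∞ :=
  ∫⁻ t in Ioc (0 : ℝ) 1, ∫⁻ u in Ioc (0 : ℝ) y, (pinv F (t ^ 2 * u)).toENNReal

/-! ### Projection-valued measures and the spectral measure of a self-adjoint operator -/

section Hilbert

variable (H : Type*) [NormedAddCommGroup H] [InnerProductSpace ℂ H] [CompleteSpace H]

/-- A projection-valued measure on the Borel sets of `ℝ`, with values in the orthogonal projections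
of the Hilbert space `H` (the value on non-measurable sets is irrelevant). -/
structure ProjMeasure where
  proj : Set ℝ → H →L[ℂ] H
  isStarProjection : ∀ B, MeasurableSet B → IsStarProjection (proj B)
  proj_univ : proj univ = 1
  proj_inter : ∀ B C, MeasurableSet B → MeasurableSet C → proj (B ∩ C) = proj B * proj C
  hasSum_iUnion : ∀ B : ℕ → Set ℝ, (∀ n, MeasurableSet (B n)) →
    Pairwise (Function.onFun Disjoint B) →
    ∀ f : H, HasSum (fun n => proj (B n) f) (proj (⋃ n, B n) f)

/-- The point mass at `0`, which is the spectral measure of the zero operator. -/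
instance : Inhabited (ProjMeasure H) where
  default := by
    classical
    exact
    { proj := fun B => if (0 : ℝ) ∈ B then 1 else 0
      isStarProjection := by
        intro B _
        split_ifs
        · exact IsStarProjection.one _
        · exact IsStarProjection.zero _
      proj_univ := by simp
      proj_inter := by
        intro B C _ _
        by_cases hB : (0 : ℝ) ∈ B <;> by_cases hC : (0 : ℝ) ∈ C <;> simp [hB, hC]
      hasSum_iUnion := by
        intro B _ hd f
        by_cases h : ∃ n, (0 : ℝ) ∈ B n
        · obtain ⟨n, hn⟩ := h
          have h0 : (0 : ℝ) ∈ ⋃ n, B n := mem_iUnion.2 ⟨n, hn⟩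
          have := hasSum_single (f := fun m => (if (0 : ℝ) ∈ B m then (1 : H →L[ℂ] H) else 0) f) n
            (by
              intro m hm
              have : (0 : ℝ) ∉ B m := fun h' => disjoint_left.1 (hd hm) h' hn
              simp [this])
          simpa [hn, h0] using this
        · have h0 : (0 : ℝ) ∉ ⋃ n, B n := by simpa using h
          have h' : ∀ n, (0 : ℝ) ∉ B n := fun n hn => h ⟨n, hn⟩
          simp [h0, h', hasSum_zero] }

variable {H}

namespace ProjMeasure

lemma nonneg (E : ProjMeasure H) (f : H) {B : Set ℝ} (hB : MeasurableSet B) :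
    0 ≤ (inner ℂ f (E.proj B f)).re := by
  have := (ContinuousLinearMap.IsPositive.of_isStarProjection (E.isStarProjection B hB)).re_inner_nonneg_right f
  simpa using this

/-- The scalar spectral measure `B ↦ ⟨f, E(B) f⟩` of a vector `f`. -/
def scalar (E : ProjMeasure H) (f : H) : Measure ℝ :=
  Measure.ofMeasurable (fun B _ => ENNReal.ofReal (inner ℂ f (E.proj B f)).re)
    (by
      have h := E.hasSum_iUnion (fun _ => ∅) (fun _ => MeasurableSet.empty)
        (fun _ _ _ => disjoint_bot_left) f
      have h0 : E.proj ∅ f = 0 := by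
        have := h.summable.tendsto_atTop_zero
        simpa using tendsto_nhds_unique tendsto_const_nhds this
      simp [h0])
    (by
      intro B hB hd
      have h := E.hasSum_iUnion B hB hd f
      have h2 : HasSum (fun n => (inner ℂ f (E.proj (B n) f)).re)
          (inner ℂ f (E.proj (⋃ n, B n) f)).re :=
        Complex.hasSum_re ((innerSL ℂ f).hasSum h)
      rw [← h2.tsum_eq, ENNReal.ofReal_tsum_of_nonneg (fun n => E.nonneg f (hB n)) h2.summable])

end ProjMeasure

/-- `E` is the spectral measure of the (possibly unbounded) operator `A`, i.e. `A = ∫ l dE(l)`: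
the domain of `A` is `{f | ∫ l² d⟨f, E(l) f⟩ < ∞}`, and `⟨f, A f⟩ = ∫ l d⟨f, E(l) f⟩` there. -/
def IsSpectralMeasure (A : H →ₗ.[ℂ] H) (E : ProjMeasure H) : Prop :=
  (∀ f : H, f ∈ A.domain ↔ ∫⁻ l, ENNReal.ofReal (l ^ 2) ∂(E.scalar f) < ∞) ∧
  ∀ f : A.domain, inner ℂ (f : H) (A f) = ((∫ l, l ∂(E.scalar (f : H)) : ℝ) : ℂ)

open Classical in
/-- The spectral measure of a self-adjoint operator `A`: the projection-valued measure `E` with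
`A = ∫ l dE(l)`, which exists and is unique by the spectral theorem when `A` is self-adjoint.
(If `A` is not self-adjoint, there is none and the value is irrelevant.) -/
def spectralMeasure (A : H →ₗ.[ℂ] H) : ProjMeasure H :=
  if h : ∃ E, IsSpectralMeasure A E then h.choose else default

/-- The spectral projection `Π_l = Π_{(-∞, l)}(A)`. -/
def specProj (A : H →ₗ.[ℂ] H) (l : ℝ) : H →L[ℂ] H :=
  (spectralMeasure A).proj (Iio l)

/-! ### Traces, states and energy -/

/-- The index set of a fixed Hilbert basis of `H`. -/
def basisIndex (H : Type*) [NormedAddCommGroup H] [InnerProductSpace ℂ H] [CompleteSpace H] :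
    Set H :=
  (exists_hilbertBasis ℂ H).choose

/-- A fixed Hilbert basis of `H`. -/
def stdBasis (H : Type*) [NormedAddCommGroup H] [InnerProductSpace ℂ H] [CompleteSpace H] :
    HilbertBasis (basisIndex H) ℂ H :=
  (exists_hilbertBasis ℂ H).choose_spec.choose

/-- The positive square root `P^{1/2}` of a positive bounded operator `P`. -/
def sqrtOp (P : H →L[ℂ] H) : H →L[ℂ] H :=
  CFC.sqrt P

lemma sqrtOp_isPositive (P : H →L[ℂ] H) : (sqrtOp P).IsPositive :=
  (ContinuousLinearMap.nonneg_iff_isPositive _).1 (CFC.sqrt_nonneg P)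

lemma sqrtOp_mul_self {P : H →L[ℂ] H} (hP : P.IsPositive) : sqrtOp P * sqrtOp P = P :=
  CFC.sqrt_mul_sqrt_self P ((ContinuousLinearMap.nonneg_iff_isPositive _).2 hP)

/-- The trace `τ(T) = ∑ ⟨e_i, T e_i⟩ ∈ [0, ∞]` of a positive bounded operator (it does not depend on
the Hilbert basis). -/
def posTrace (T : H →L[ℂ] H) : ℝ≥0∞ :=
  ∑' i, ENNReal.ofReal (inner ℂ (stdBasis H i) (T (stdBasis H i))).re

/-- A mixed state: a positive trace class operator. -/
def IsState (ρ : H →L[ℂ] H) : Prop :=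
  ρ.IsPositive ∧ posTrace ρ < ∞

/-- `τ(ρ^{1/2} g(A) ρ^{1/2}) ∈ [0, ∞]`, for a Borel function `g ≥ 0` on `ℝ`: with the Borel
functional calculus, the quadratic form of `g(A)` at `f` is `∫ g(l) d⟨f, E(l) f⟩`. -/
def traceFun (A : H →ₗ.[ℂ] H) (ρ : H →L[ℂ] H) (g : ℝ → ℝ≥0∞) : ℝ≥0∞ :=
  ∑' i, ∫⁻ l, g l ∂((spectralMeasure A).scalar (sqrtOp ρ (stdBasis H i)))

/-- `𝓔⁺(ρ) = τ(ρ^{1/2} max(A, 0) ρ^{1/2})`. -/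
def energyPos (A : H →ₗ.[ℂ] H) (ρ : H →L[ℂ] H) : ℝ≥0∞ :=
  traceFun A ρ fun l => ENNReal.ofReal (max l 0)

/-- `𝓔⁻(ρ) = τ(ρ^{1/2} max(-A, 0) ρ^{1/2})`. -/
def energyNeg (A : H →ₗ.[ℂ] H) (ρ : H →L[ℂ] H) : ℝ≥0∞ :=
  traceFun A ρ fun l => ENNReal.ofReal (max (-l) 0)

/-- The energy `𝓔(ρ) = τ(ρ A) = 𝓔⁺(ρ) - 𝓔⁻(ρ)`, in `[-∞, ∞)` when `𝓔⁺(ρ)` is finite. -/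
def energy (A : H →ₗ.[ℂ] H) (ρ : H →L[ℂ] H) : EReal :=
  (energyPos A ρ : EReal) - (energyNeg A ρ : EReal)

end Hilbert

/-! ### Densities on `L²(X, V)` -/

section Density

variable {X V : Type*} [MeasurableSpace X] {μ : Measure X}
  [NormedAddCommGroup V] [InnerProductSpace ℂ V] [CompleteSpace V]

/-- Multiplication by the indicator function `χ_Ω` on `L²(X, V)`. -/
def chi {Ω : Set X} (hΩ : MeasurableSet Ω) : Lp V 2 μ →L[ℂ] Lp V 2 μ :=
  LinearMap.mkContinuous
    { toFun := fun f => ((Lp.memLp f).indicator hΩ).toLp (Ω.indicator f)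
      map_add' := by
        intro f g
        rw [← MemLp.toLp_add]
        refine MemLp.toLp_congr _ _ ?_
        filter_upwards [Lp.coeFn_add f g] with x hx
        by_cases h : x ∈ Ω
        · simpa [h] using hx
        · simp [h]
      map_smul' := by
        intro c f
        rw [RingHom.id_apply, ← MemLp.toLp_const_smul]
        refine MemLp.toLp_congr _ _ ?_
        filter_upwards [Lp.coeFn_smul c f] with x hx
        by_cases h : x ∈ Ω
        · simpa [h] using hx
        · simp [h] }
    1
    (by
      intro f
      rw [one_mul, LinearMap.coe_mk, AddHom.coe_mk, Lp.norm_toLp, Lp.norm_def]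
      exact ENNReal.toReal_mono (Lp.eLpNorm_ne_top f) (eLpNorm_indicator_le _))

lemma coeFn_chi {Ω : Set X} (hΩ : MeasurableSet Ω) (f : Lp V 2 μ) :
    (chi hΩ f : X → V) =ᵐ[μ] Ω.indicator f := by
  have h : chi hΩ f = ((Lp.memLp f).indicator hΩ).toLp (Ω.indicator f) := rfl
  rw [h]
  exact MemLp.coeFn_toLp _

lemma ofReal_inner_chi {Ω : Set X} (hΩ : MeasurableSet Ω) (f : Lp V 2 μ) :
    ENNReal.ofReal (inner ℂ f (chi hΩ f)).re = ∫⁻ x in Ω, ‖f x‖ₑ ^ 2 ∂μ := by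
  have h1 : inner ℂ f (chi hΩ f) = ((∫ x, Ω.indicator (fun x => ‖f x‖ ^ 2) x ∂μ : ℝ) : ℂ) := by
    rw [L2.inner_def, ← integral_complex_ofReal]
    refine integral_congr_ae ?_
    filter_upwards [coeFn_chi hΩ f] with x hx
    rw [hx]
    by_cases h : x ∈ Ω <;> simp [h]
  rw [h1, Complex.ofReal_re, integral_indicator hΩ, ofReal_integral_eq_lintegral_ofReal]
  · refine lintegral_congr fun x => ?_
    rw [ENNReal.ofReal_pow (norm_nonneg _), ofReal_norm]
  · exact ((memLp_two_iff_integrable_sq_norm (Lp.memLp f).1).1 (Lp.memLp f)).integrableOn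
  · exact Filter.Eventually.of_forall fun x => by positivity

lemma posTrace_sqrt_chi (P : Lp V 2 μ →L[ℂ] Lp V 2 μ) {Ω : Set X} (hΩ : MeasurableSet Ω) :
    posTrace (sqrtOp P * chi hΩ * sqrtOp P) =
      ∑' i, ∫⁻ x in Ω, ‖(sqrtOp P (stdBasis (Lp V 2 μ) i) : Lp V 2 μ) x‖ₑ ^ 2 ∂μ := by
  refine tsum_congr fun i => ?_
  rw [← ofReal_inner_chi hΩ]
  have := (sqrtOp_isPositive P).isSymmetric (stdBasis (Lp V 2 μ) i)
    (chi hΩ (sqrtOp P (stdBasis (Lp V 2 μ) i)))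
  exact congrArg (fun z : ℂ => ENNReal.ofReal z.re) this.symm

/-- The measure `ν_P(Ω) = τ(P^{1/2} χ_Ω P^{1/2})` of a bounded positive operator `P`. -/
def nu (P : Lp V 2 μ →L[ℂ] Lp V 2 μ) : Measure X :=
  Measure.ofMeasurable (fun _ hΩ => posTrace (sqrtOp P * chi hΩ * sqrtOp P))
    (by rw [posTrace_sqrt_chi]; simp)
    (by
      intro B hB hd
      simp_rw [posTrace_sqrt_chi]
      rw [ENNReal.tsum_comm]
      refine tsum_congr fun i => ?_
      rw [lintegral_iUnion hB hd])

/-- The density function `Dν_P = dν_P/dμ`, with values in `[0, ∞]`. For a countable Hilbert basis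
`(e_i)` it is a.e. equal to `∑ ‖(P^{1/2} e_i)(x)‖²`. -/
def density (P : Lp V 2 μ →L[ℂ] Lp V 2 μ) : X → ℝ≥0∞ :=
  (nu P).rnDeriv μ

/-- The spectral measure `F_Ω(l) = ν_{Π_l}(Ω)` of a measurable set `Ω`. -/
def specF (A : Lp V 2 μ →ₗ.[ℂ] Lp V 2 μ) (Ω : Set X) (l : ℝ) : ℝ≥0∞ :=
  nu (specProj A l) Ω

/-- The spectral density function `F_x(l) = Dν_{Π_l}(x)`. For each `l` this is defined up to a null
set of `x`; we take the version which is increasing and left continuous in `l` for every `x`,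
namely the supremum of `Dν_{Π_q}(x)` over the rationals `q < l`. -/
def specDensity (A : Lp V 2 μ →ₗ.[ℂ] Lp V 2 μ) (x : X) (l : ℝ) : ℝ≥0∞ :=
  ⨆ (q : ℚ) (_ : (q : ℝ) < l), density (specProj A q) x

/-- The argument `ν_ρ(Ω) / ‖ρ‖_∞` of `ψ_Ω`. -/
def argSet (ρ : Lp V 2 μ →L[ℂ] Lp V 2 μ) (Ω : Set X) : ℝ :=
  (nu ρ Ω).toReal / ‖ρ‖

/-- The argument `Dν_ρ(x) / ‖ρ‖_∞` of `ψ_x`. -/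
def argPt (ρ : Lp V 2 μ →L[ℂ] Lp V 2 μ) (x : X) : ℝ :=
  (density ρ x).toReal / ‖ρ‖

/-- `ψ_Ω(ν_ρ(Ω) / ‖ρ‖_∞)`. -/
def psiSet (A : Lp V 2 μ →ₗ.[ℂ] Lp V 2 μ) (ρ : Lp V 2 μ →L[ℂ] Lp V 2 μ) (Ω : Set X) : EReal :=
  psi (specF A Ω) (argSet ρ Ω)

/-- `ψ_x(Dν_ρ(x) / ‖ρ‖_∞)`. -/
def psiPt (A : Lp V 2 μ →ₗ.[ℂ] Lp V 2 μ) (ρ : Lp V 2 μ →L[ℂ] Lp V 2 μ) (x : X) : EReal :=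
  psi (specDensity A x) (argPt ρ x)

/-- `H_{Ω_i}(ρ) = ‖ρ‖_∞ ∑ ψ_{Ω_i}(ν_ρ(Ω_i) / ‖ρ‖_∞)`. -/
def partitionH (A : Lp V 2 μ →ₗ.[ℂ] Lp V 2 μ) (ρ : Lp V 2 μ →L[ℂ] Lp V 2 μ) {ι : Type*}
    (Ω : ι → Set X) : EReal :=
  ((‖ρ‖ : ℝ) : EReal) * esum fun i => psiSet A ρ (Ω i)

/-- `H(ρ) = ‖ρ‖_∞ ∫ ψ_x(Dν_ρ(x) / ‖ρ‖_∞) dμ(x)`. -/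
def continuousH (A : Lp V 2 μ →ₗ.[ℂ] Lp V 2 μ) (ρ : Lp V 2 μ →L[ℂ] Lp V 2 μ) : EReal :=
  ((‖ρ‖ : ℝ) : EReal) * eint μ (psiPt A ρ)

/-- A family of measurable sets which is a partition of `X` (some of the sets may be empty). -/
def IsMeasurablePartition {ι : Type*} (Ω : ι → Set X) : Prop :=
  (∀ i, MeasurableSet (Ω i)) ∧ Pairwise (Function.onFun Disjoint Ω) ∧ ⋃ i, Ω i = univ

/-- The partition `Ω'` is finer than `Ω`. -/
def IsFiner {ι κ : Type*} (Ω' : κ → Set X) (Ω : ι → Set X) : Prop :=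
  ∀ j, ∃ i, Ω' j ⊆ Ω i

end Density

end BalancedLT

end

noncomputable section

namespace BalancedLT

/-!
The inequalities below hold for every projection-valued measure in the role of the spectral measure
of `A`: only the projections `E(B)` and the scalar measures `⟨f, E(·) f⟩` enter, and `H` and the
energy are all computed from the same `E`. So the spectral theorem is not used.
-/

/-! ### Differences of `ℝ≥0∞`-valued functions -/

/-! Everything reduces to one energy level `l` at a time. The layer-cake formula writes the positive
part of `F⁻¹(t²u)` as the length of `{l > 0 | F l ≤ t²u}` and its negative part as the length of `{l
≤ 0 | t²u < F l}`. Integrating over `u` and `t` first turns `ψ(y)` into `∫_{l>0} h(y, F l) dl -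
∫_{l≤0} q(y, F l) dl`, where `h(y, F) = ∫_0^1 (y - F/t²)⁺ dt = ((√y - √F)⁺)²` and `h + q = y`
(`psiPosPart_eq`, `psiNegPart_eq`). The energy has the same shape: `∫_{l>0} m([l, ∞)) dl - ∫_{l≤0}
m((-∞, l)) dl`, where `m` is the distribution of energy in the state.

Comparing partitions, or a partition with densities, uses only that `(y - F/t²)⁺` is subadditive in
`(y, F)`: cutting a set into pieces can only increase the total of `h` and decrease the total of `q`
(`hfun_integral_le`, `lintegral_qfun_le`). The same argument serves counting measure on the blocks
and `μ` restricted to a block.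

The bound by the energy is a pointwise uncertainty principle. Split each `f = ρ^{1/2} e_i` into its
low part `Π_l f` and its high part. The low parts have total density at most `‖ρ‖ Dν_{Π_l}`, so at
almost every point the high parts have density at least `‖ρ‖ h(Dν_ρ/‖ρ‖, Dν_{Π_l})` (`low_le`,
`hfun_argPt_le`). The high density integrates over `X` to `m([l, ∞))`; integrating in `l > 0` bounds
the positive part, and complementing in the finite total mass `τ(ρ)` bounds the negative part.

Positive and negative parts are compared separately in `ℝ≥0∞`, so `∞ - ∞` never arises. -/

lemma coe_sub_eq_of_add_eq {a b p q : ℝ≥0∞} (ha : a ≠ ∞) (hp : p ≠ ∞) (h : a + q = b + p) :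
    (a : EReal) - b = (p : EReal) - q := by
  by_cases hq : q = ∞
  · subst hq
    have hb : b = ∞ := by
      by_contra hb
      exact ENNReal.add_ne_top.2 ⟨hb, hp⟩ (by rw [← h]; simp)
    subst hb
    simp
  · have hb : b ≠ ∞ := by
      rintro rfl
      exact ENNReal.add_ne_top.2 ⟨ha, hq⟩ (by rw [h]; simp)
    lift a to NNReal using ha
    lift b to NNReal using hb
    lift p to NNReal using hp
    lift q to NNReal using hq
    have h' : (a : ℝ) + q = b + p := by exact_mod_cast h
    have : (a : ℝ) - b = p - q := by linarith
    have h2 : (((a : ℝ) - b : ℝ) : EReal) = ((p - q : ℝ) : EReal) := by rw [this]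
    exact h2

lemma toENNReal_neg_coe_sub {p q : ℝ≥0∞} (hp : p ≠ ∞) :
    (-((p : EReal) - q)).toENNReal = q - p := by
  rw [EReal.neg_sub (Or.inl (EReal.coe_ennreal_ne_bot p)) (Or.inl (by simpa using hp)),
    add_comm, ← sub_eq_add_neg, EReal.toENNReal_sub (EReal.coe_ennreal_nonneg p)]
  simp

lemma toENNReal_coe_sub (p q : ℝ≥0∞) : ((p : EReal) - q).toENNReal = p - q := by
  rw [EReal.toENNReal_sub (EReal.coe_ennreal_nonneg q)]
  simp

lemma eint_congr {α : Type*} [MeasurableSpace α] {μ : Measure α} {f g : α → EReal}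
    (h : f =ᵐ[μ] g) : eint μ f = eint μ g := by
  unfold eint
  have h1 : ∫⁻ a, (f a).toENNReal ∂μ = ∫⁻ a, (g a).toENNReal ∂μ :=
    lintegral_congr_ae (h.fun_comp EReal.toENNReal)
  have h2 : ∫⁻ a, (-f a).toENNReal ∂μ = ∫⁻ a, (-g a).toENNReal ∂μ :=
    lintegral_congr_ae (h.fun_comp fun z => (-z).toENNReal)
  rw [h1, h2]

/-- `P` and `Q` may overlap, so they are not the positive and negative parts of `P - Q`. But `(P -
Q)⁺ + Q = (Q - P)⁺ + P` pointwise, and this additive identity survives integration even where `Q`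
has infinite integral. -/
lemma eint_coe_sub {α : Type*} [MeasurableSpace α] {μ : Measure α} {P Q : α → ℝ≥0∞}
    (hP : AEMeasurable P μ) (hQ : AEMeasurable Q μ) (hfin : ∫⁻ a, P a ∂μ ≠ ∞) :
    eint μ (fun a => (P a : EReal) - Q a) =
      ((∫⁻ a, P a ∂μ : ℝ≥0∞) : EReal) - ((∫⁻ a, Q a ∂μ : ℝ≥0∞) : EReal) := by
  have hP' : ∀ᵐ a ∂μ, P a < ∞ := ae_lt_top' hP hfin
  have h1 : ∫⁻ a, (((P a : EReal) - Q a)).toENNReal ∂μ = ∫⁻ a, (P a - Q a) ∂μ :=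
    lintegral_congr fun a => toENNReal_coe_sub _ _
  have h2 : ∫⁻ a, (-((P a : EReal) - Q a)).toENNReal ∂μ = ∫⁻ a, (Q a - P a) ∂μ :=
    lintegral_congr_ae (hP'.mono fun a ha => toENNReal_neg_coe_sub ha.ne)
  unfold eint
  rw [h1, h2]
  refine coe_sub_eq_of_add_eq
    (ne_top_of_le_ne_top hfin (lintegral_mono fun a => tsub_le_self)) hfin ?_
  rw [← lintegral_add_right' _ hQ, ← lintegral_add_right' _ hP]
  refine lintegral_congr fun a => ?_
  rcases le_total (P a) (Q a) with h | h
  · rw [tsub_eq_zero_of_le h, zero_add, tsub_add_cancel_of_le h]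
  · rw [tsub_eq_zero_of_le h, zero_add, tsub_add_cancel_of_le h]

lemma esum_coe_sub {ι : Type*} {P Q : ι → ℝ≥0∞} (hfin : ∑' i, P i ≠ ∞) :
    esum (fun i => (P i : EReal) - Q i) =
      ((∑' i, P i : ℝ≥0∞) : EReal) - ((∑' i, Q i : ℝ≥0∞) : EReal) := by
  let _ : MeasurableSpace ι := ⊤
  have := eint_coe_sub (μ := Measure.count) (P := P) (Q := Q) measurable_from_top.aemeasurable
    measurable_from_top.aemeasurable (by rwa [lintegral_count])
  simpa only [eint, esum, lintegral_count] using this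

/-! ### The kernels of the double integral -/

/-- `hfun y F = ∫_0^1 (y - F / t²)⁺ dt = ((√y - √F)⁺)²`. -/
def hfun (y F : ℝ≥0∞) : ℝ≥0∞ :=
  ∫⁻ t in Ioc (0 : ℝ) 1, (y - F / ENNReal.ofReal (t ^ 2))

/-- `qfun y F = ∫_0^1 min (y, F / t²) dt = y - hfun y F`. -/
def qfun (y F : ℝ≥0∞) : ℝ≥0∞ :=
  ∫⁻ t in Ioc (0 : ℝ) 1, min y (F / ENNReal.ofReal (t ^ 2))

lemma measurable_hfun : Measurable fun p : ℝ≥0∞ × ℝ≥0∞ => hfun p.1 p.2 := by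
  unfold hfun
  refine Measurable.lintegral_prod_right'
    (f := fun z : (ℝ≥0∞ × ℝ≥0∞) × ℝ => z.1.1 - z.1.2 / ENNReal.ofReal (z.2 ^ 2)) ?_
  fun_prop

lemma measurable_qfun : Measurable fun p : ℝ≥0∞ × ℝ≥0∞ => qfun p.1 p.2 := by
  unfold qfun
  refine Measurable.lintegral_prod_right'
    (f := fun z : (ℝ≥0∞ × ℝ≥0∞) × ℝ => min z.1.1 (z.1.2 / ENNReal.ofReal (z.2 ^ 2))) ?_
  fun_prop

lemma hfun_add_qfun (y F : ℝ≥0∞) : hfun y F + qfun y F = y := by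
  unfold hfun qfun
  rw [← lintegral_add_left (by fun_prop)]
  have : ∀ t : ℝ, y - F / ENNReal.ofReal (t ^ 2) + min y (F / ENNReal.ofReal (t ^ 2)) = y :=
    fun t => by rw [← tsub_min, tsub_add_cancel_of_le (min_le_left _ _)]
  simp [this]

lemma hfun_le (y F : ℝ≥0∞) : hfun y F ≤ y :=
  le_self_add.trans (hfun_add_qfun y F).le

lemma hfun_anti {y F F' : ℝ≥0∞} (h : F ≤ F') : hfun y F' ≤ hfun y F :=
  lintegral_mono fun _ => tsub_le_tsub_left (ENNReal.div_le_div_right h _) _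

/-- For each fixed `t`, the positive part of an integral is at most the integral of the positive
part. An upper bound `F₀` is enough because `h` decreases in `F`. -/
lemma hfun_integral_le {α : Type*} [MeasurableSpace α] {m : Measure α} [SFinite m]
    {y F : α → ℝ≥0∞} (hy : Measurable y) (hF : Measurable F) {F₀ : ℝ≥0∞}
    (hF₀ : ∫⁻ a, F a ∂m ≤ F₀) :
    hfun (∫⁻ a, y a ∂m) F₀ ≤ ∫⁻ a, hfun (y a) (F a) ∂m := by
  unfold hfun
  rw [lintegral_lintegral_swap (by fun_prop)]
  refine lintegral_mono fun t => ?_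
  refine tsub_le_iff_right.2 ?_
  calc ∫⁻ a, y a ∂m
      ≤ ∫⁻ a, ((y a - F a / ENNReal.ofReal (t ^ 2)) + F a / ENNReal.ofReal (t ^ 2)) ∂m :=
        lintegral_mono fun a => le_tsub_add
    _ = ∫⁻ a, (y a - F a / ENNReal.ofReal (t ^ 2)) ∂m
          + (∫⁻ a, F a ∂m) / ENNReal.ofReal (t ^ 2) := by
        rw [lintegral_add_right _ (by fun_prop)]
        simp_rw [div_eq_mul_inv]
        rw [lintegral_mul_const _ hF]
    _ ≤ _ := add_le_add le_rfl (ENNReal.div_le_div_right hF₀ _)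

/-- Since `h + q = y`, this is the complement of the inequality for `h`; finiteness of the total of
`y` allows the cancellation. -/
lemma lintegral_qfun_le {α : Type*} [MeasurableSpace α] {m : Measure α} [SFinite m]
    {y F : α → ℝ≥0∞} (hy : Measurable y) (hF : Measurable F) (hfin : ∫⁻ a, y a ∂m ≠ ∞)
    {F₀ : ℝ≥0∞} (hF₀ : ∫⁻ a, F a ∂m ≤ F₀) :
    ∫⁻ a, qfun (y a) (F a) ∂m ≤ qfun (∫⁻ a, y a ∂m) F₀ := by
  have hh := hfun_integral_le hy hF hF₀
  have h1 : hfun (∫⁻ a, y a ∂m) F₀ ≠ ∞ := ne_top_of_le_ne_top hfin (hfun_le _ _)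
  refine (ENNReal.add_le_add_iff_left h1).1 ?_
  rw [hfun_add_qfun]
  refine (add_le_add_left hh _).trans ?_
  have hm : Measurable fun a => hfun (y a) (F a) := measurable_hfun.comp (hy.prodMk hF)
  rw [← lintegral_add_left hm]
  simp_rw [hfun_add_qfun]
  exact le_rfl

lemma hfun_ofReal_le {y F : ℝ} (hF : 0 < F) (hFy : F < y) :
    hfun (ENNReal.ofReal y) (ENNReal.ofReal F) ≤
      ENNReal.ofReal ((1 - √(F / y)) * y - (1 / √(F / y) - 1) * F) := by
  have hy : 0 < y := hF.trans hFy
  set s := √(F / y) with hs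
  have hs0 : 0 < s := Real.sqrt_pos.2 (by positivity)
  have hs2 : s ^ 2 = F / y := Real.sq_sqrt (by positivity)
  have hs1 : s ≤ 1 := Real.sqrt_le_one.2 (by rw [div_le_one hy]; exact hFy.le)
  -- The integrand `y - F/t²` changes sign at `t = s`, so only `[s, 1]` contributes.
  have hderiv : ∀ t ∈ uIcc s 1, HasDerivAt (fun t : ℝ => y * t + F * t⁻¹) (y - F / t ^ 2) t := by
    intro t ht
    rw [uIcc_of_le hs1] at ht
    have ht0 : t ≠ 0 := (hs0.trans_le ht.1).ne'
    have := ((hasDerivAt_id t).const_mul y).add ((hasDerivAt_inv ht0).const_mul F)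
    rw [mul_one, mul_neg, ← sub_eq_add_neg, ← div_eq_mul_inv] at this
    exact this
  have hcont : ContinuousOn (fun t : ℝ => y - F / t ^ 2) (uIcc s 1) := by
    rw [uIcc_of_le hs1]
    refine continuousOn_const.sub (continuousOn_const.div (by fun_prop) fun t ht => ?_)
    exact pow_ne_zero _ (hs0.trans_le ht.1).ne'
  have hint := intervalIntegral.integral_eq_sub_of_hasDerivAt hderiv hcont.intervalIntegrable
  have hval : (1 - s) * y - (1 / s - 1) * F = ∫ t in s..1, (y - F / t ^ 2) := by
    rw [hint]
    ring
  rw [hval, intervalIntegral.integral_of_le hs1, ofReal_integral_eq_lintegral_ofReal]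
  · unfold hfun
    have hsplit : Ioc (0 : ℝ) 1 = Ioc 0 s ∪ Ioc s 1 := (Ioc_union_Ioc_eq_Ioc hs0.le hs1).symm
    rw [hsplit]
    refine (lintegral_union_le _ _ _).trans ?_
    have hz : ∫⁻ t in Ioc 0 s,
        (ENNReal.ofReal y - ENNReal.ofReal F / ENNReal.ofReal (t ^ 2)) = 0 := by
      rw [setLIntegral_congr_fun (g := fun _ => 0) measurableSet_Ioc]
      · simp
      · intro t ht
        have ht2 : 0 < t ^ 2 := pow_pos ht.1 2
        simp only
        rw [← ENNReal.ofReal_div_of_pos ht2]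
        refine tsub_eq_zero_of_le (ENNReal.ofReal_le_ofReal ?_)
        rw [le_div_iff₀ ht2]
        have : t ^ 2 ≤ F / y := hs2 ▸ pow_le_pow_left₀ ht.1.le ht.2 2
        rw [le_div_iff₀ hy] at this
        linarith
    rw [hz, zero_add]
    refine (setLIntegral_congr_fun measurableSet_Ioc fun t ht => ?_).le
    have ht2 : 0 < t ^ 2 := pow_pos (hs0.trans ht.1) 2
    rw [← ENNReal.ofReal_div_of_pos ht2, ENNReal.ofReal_sub _ (by positivity)]
  · exact (intervalIntegrable_iff_integrableOn_Ioc_of_le hs1).1 hcont.intervalIntegrable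
  · refine (ae_restrict_iff' measurableSet_Ioc).2 (Filter.Eventually.of_forall fun t ht => ?_)
    have ht2 : 0 < t ^ 2 := pow_pos (hs0.trans ht.1) 2
    change (0 : ℝ) ≤ y - F / t ^ 2
    rw [sub_nonneg, div_le_iff₀ ht2]
    have : F / y ≤ t ^ 2 := hs2 ▸ pow_le_pow_left₀ hs0.le ht.1.le 2
    rw [div_le_iff₀ hy] at this
    linarith

/-- `h(y, F)` is the supremum over `s` of `(1 - s) y - (1/s - 1) F`, reached at `s = √(F/y)` when `0
< F < y`. Each bound is linear in the densities, hence follows from set-wise bounds, and rational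
`s` keep the exceptional null sets countable in number. -/
lemma hfun_le_of_forall_rat {y F G : ℝ≥0∞} (hy : y ≠ ∞)
    (h : ∀ s : ℚ, 0 < s → s < 1 →
      ENNReal.ofReal (1 - s) * y ≤ G + ENNReal.ofReal (1 / s - 1) * F) : hfun y F ≤ G := by
  by_cases hG : G = ∞
  · simp [hG]
  rcases le_or_gt y F with hyF | hFy
  · refine le_trans (le_of_eq ?_) zero_le
    unfold hfun
    rw [setLIntegral_congr_fun (g := fun _ => 0) measurableSet_Ioc]
    · simp
    · intro t ht
      refine tsub_eq_zero_of_le (hyF.trans ?_)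
      rw [ENNReal.le_div_iff_mul_le (Or.inl (by simpa using ht.1.ne')) (Or.inl (by simp))]
      exact mul_le_of_le_one_right zero_le
        (ENNReal.ofReal_le_one.2 (pow_le_one₀ ht.1.le ht.2))
  have hF : F ≠ ∞ := ne_top_of_lt hFy
  lift y to NNReal using hy
  lift F to NNReal using hF
  lift G to NNReal using hG
  have hFy' : (F : ℝ) < y := by exact_mod_cast hFy
  have hreal : ∀ s : ℚ, 0 < s → s < 1 → (1 - (s : ℝ)) * y ≤ G + (1 / (s : ℝ) - 1) * F := by
    intro s h0 h1
    have hs0 : (0 : ℝ) < s := by exact_mod_cast h0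
    have hs1 : (s : ℝ) < 1 := by exact_mod_cast h1
    have h2 := h s h0 h1
    have e1 : (0 : ℝ) ≤ 1 - s := by linarith
    have e2 : (0 : ℝ) ≤ 1 / s - 1 := by
      rw [sub_nonneg, le_div_iff₀ hs0]; linarith
    rw [← ENNReal.ofReal_coe_nnreal (p := y), ← ENNReal.ofReal_coe_nnreal (p := F),
      ← ENNReal.ofReal_coe_nnreal (p := G), ← ENNReal.ofReal_mul e1, ← ENNReal.ofReal_mul e2,
      ← ENNReal.ofReal_add G.coe_nonneg (mul_nonneg e2 F.coe_nonneg),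
      ENNReal.ofReal_le_ofReal_iff (add_nonneg G.coe_nonneg (mul_nonneg e2 F.coe_nonneg))] at h2
    exact h2
  have hreal' : ∀ s : ℝ, 0 < s → s < 1 → (1 - s) * y ≤ G + (1 / s - 1) * F := by
    intro s h0 h1
    by_contra hcon
    rw [not_le] at hcon
    have hc : ContinuousAt (fun s : ℝ => (1 - s) * y - (G + (1 / s - 1) * F)) s := by
      have : s ≠ 0 := h0.ne'
      fun_prop (disch := assumption)
    have hev : ∀ᶠ r : ℝ in nhds s, 0 < (1 - r) * y - (G + (1 / r - 1) * F) :=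
      hc.eventually (lt_mem_nhds (sub_pos.2 hcon))
    obtain ⟨u, hu, huo, hsu⟩ := mem_nhds_iff.1 (hev.and (Ioo_mem_nhds h0 h1))
    obtain ⟨q, hq⟩ := Rat.denseRange_cast.exists_mem_open huo ⟨s, hsu⟩
    have h3 := hu hq
    have h4 := hreal q (by exact_mod_cast h3.2.1) (by exact_mod_cast h3.2.2)
    linarith [h3.1]
  -- For `F = 0` the optimal `s` would be `0`, outside the allowed range, so it is approached within
  -- `ε`.
  rcases eq_or_ne F 0 with rfl | hF0
  · have : (y : ℝ) ≤ G := by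
      refine le_of_forall_pos_lt_add fun ε hε => ?_
      by_contra hcon
      rw [not_lt] at hcon
      have hypos : (0 : ℝ) < y := by exact_mod_cast hFy'
      have h5 := hreal' (min (1 / 2) (ε / (2 * y))) (by positivity)
        ((min_le_left _ _).trans_lt (by norm_num))
      have h6 : min (1 / 2) (ε / (2 * y)) * y ≤ ε / 2 := by
        refine (mul_le_mul_of_nonneg_right (min_le_right _ _) hypos.le).trans (le_of_eq ?_)
        field_simp
      simp only [NNReal.coe_zero, mul_zero, add_zero] at h5
      linarith
    exact (hfun_le _ _).trans (by exact_mod_cast this)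
  · have hFpos : (0 : ℝ) < F := by exact_mod_cast pos_iff_ne_zero.2 hF0
    have h7 := hfun_ofReal_le hFpos hFy'
    rw [ENNReal.ofReal_coe_nnreal, ENNReal.ofReal_coe_nnreal] at h7
    refine h7.trans ?_
    have hypos : (0 : ℝ) < y := hFpos.trans hFy'
    have hs0 : 0 < √((F : ℝ) / y) := Real.sqrt_pos.2 (by positivity)
    have hs1 : √((F : ℝ) / y) < 1 := by
      rw [← Real.sqrt_one]
      exact Real.sqrt_lt_sqrt (by positivity) (by rwa [div_lt_one hypos])
    refine ENNReal.ofReal_le_of_le_toReal ?_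
    have := hreal' _ hs0 hs1
    simp only [ENNReal.coe_toReal]
    linarith

/-! ### Layer-cake formulas for the pseudo-inverse -/

lemma volume_pos_lt (p : EReal) : volume {l : ℝ | 0 < l ∧ (l : EReal) < p} = p.toENNReal := by
  induction p with
  | bot => simp
  | top =>
    have : {l : ℝ | 0 < l ∧ (l : EReal) < ⊤} = Ioi 0 := by ext; simp
    rw [this]; simp
  | coe r =>
    have : {l : ℝ | 0 < l ∧ (l : EReal) < r} = Ioo 0 r := by ext; simp
    rw [this]; simp

lemma volume_pos_le (p : EReal) : volume {l : ℝ | 0 < l ∧ (l : EReal) ≤ p} = p.toENNReal := by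
  induction p with
  | bot => simp
  | top =>
    have : {l : ℝ | 0 < l ∧ (l : EReal) ≤ ⊤} = Ioi 0 := by ext; simp
    rw [this]; simp
  | coe r =>
    have : {l : ℝ | 0 < l ∧ (l : EReal) ≤ r} = Ioc 0 r := by ext; simp
    rw [this]; simp

lemma volume_nonpos_gt (p : EReal) :
    volume {l : ℝ | l ≤ 0 ∧ p < (l : EReal)} = (-p).toENNReal := by
  induction p with
  | bot =>
    have : {l : ℝ | l ≤ 0 ∧ ⊥ < (l : EReal)} = Iic 0 := by ext; simp
    rw [this]; simp
  | top => simp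
  | coe r =>
    have : {l : ℝ | l ≤ 0 ∧ (r : EReal) < l} = Ioc r 0 := by ext; simp [and_comm]
    rw [this, ← EReal.coe_neg]; simp

lemma volume_nonpos_ge (p : EReal) :
    volume {l : ℝ | l ≤ 0 ∧ p ≤ (l : EReal)} = (-p).toENNReal := by
  induction p with
  | bot =>
    have : {l : ℝ | l ≤ 0 ∧ ⊥ ≤ (l : EReal)} = Iic 0 := by ext; simp
    rw [this]; simp
  | top => simp
  | coe r =>
    have : {l : ℝ | l ≤ 0 ∧ (r : EReal) ≤ l} = Icc r 0 := by ext; simp [and_comm]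
    rw [this, ← EReal.coe_neg]; simp

lemma le_pinv {F : ℝ → ℝ≥0∞} {y l : ℝ} (h : F l ≤ ENNReal.ofReal y) : (l : EReal) ≤ pinv F y :=
  le_sSup ⟨l, h, rfl⟩

lemma le_of_lt_pinv {F : ℝ → ℝ≥0∞} (hF : Monotone F) {y l : ℝ} (h : (l : EReal) < pinv F y) :
    F l ≤ ENNReal.ofReal y := by
  obtain ⟨z, ⟨x, hx, rfl⟩, hz⟩ := lt_sSup_iff.1 h
  exact (hF (EReal.coe_lt_coe_iff.1 hz).le).trans hx

/-- The sublevel set lies between the half-lines `l < F⁻¹(y)` and `l ≤ F⁻¹(y)`, whose positive parts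
have the same length; whether the endpoint belongs does not matter. -/
lemma toENNReal_pinv {F : ℝ → ℝ≥0∞} (hF : Monotone F) (y : ℝ) :
    (pinv F y).toENNReal = volume.restrict (Ioi 0) {l | F l ≤ ENNReal.ofReal y} := by
  rw [Measure.restrict_apply (measurableSet_le hF.measurable measurable_const)]
  refine le_antisymm ?_ ?_
  · rw [← volume_pos_lt]
    exact measure_mono fun l hl => ⟨le_of_lt_pinv hF hl.2, hl.1⟩
  · rw [← volume_pos_le]
    exact measure_mono fun l hl => ⟨hl.2, le_pinv hl.1⟩

lemma toENNReal_neg_pinv {F : ℝ → ℝ≥0∞} (hF : Monotone F) (y : ℝ) :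
    (-pinv F y).toENNReal = volume.restrict (Iic 0) {l | ENNReal.ofReal y < F l} := by
  rw [Measure.restrict_apply (measurableSet_lt measurable_const hF.measurable)]
  refine le_antisymm ?_ ?_
  · rw [← volume_nonpos_gt]
    exact measure_mono fun l hl => ⟨not_le.1 fun h => not_le.2 hl.2 (le_pinv h), hl.1⟩
  · rw [← volume_nonpos_ge]
    exact measure_mono fun l hl => ⟨hl.2, not_lt.1 fun h => not_le.2 hl.1 (le_of_lt_pinv hF h)⟩

lemma pinv_mono (F : ℝ → ℝ≥0∞) : Monotone (pinv F) := by
  intro y y' h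
  refine sSup_le_sSup ?_
  rintro z ⟨x, hx, rfl⟩
  exact ⟨x, hx.trans (ENNReal.ofReal_le_ofReal h), rfl⟩

lemma measurable_pinv_sq_mul (F : ℝ → ℝ≥0∞) :
    Measurable fun p : ℝ × ℝ => pinv F (p.1 ^ 2 * p.2) :=
  (pinv_mono F).measurable.comp (by fun_prop)

/-- The negative part of the double integral in `ψ(y)`. -/
def psiNegPart (F : ℝ → ℝ≥0∞) (y : ℝ) : ℝ≥0∞ :=
  ∫⁻ t in Ioc (0 : ℝ) 1, ∫⁻ u in Ioc (0 : ℝ) y, (-pinv F (t ^ 2 * u)).toENNReal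

lemma psi_eq {F : ℝ → ℝ≥0∞} {y : ℝ} (h : psiPosPart F y ≠ ∞) :
    psi F y = (psiPosPart F y : EReal) - (psiNegPart F y : EReal) := by
  -- `phi` is by definition a difference of two lower integrals, so only the outer integral has to
  -- be split.
  refine eint_coe_sub (Measurable.aemeasurable ?_) (Measurable.aemeasurable ?_) h
  · exact Measurable.lintegral_prod_right'
      (f := fun p : ℝ × ℝ => (pinv F (p.1 ^ 2 * p.2)).toENNReal)
      (measurable_pinv_sq_mul F).ereal_toENNReal
  · exact Measurable.lintegral_prod_right'
      (f := fun p : ℝ × ℝ => (-pinv F (p.1 ^ 2 * p.2)).toENNReal)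
      (measurable_pinv_sq_mul F).neg.ereal_toENNReal

lemma volume_le_sq_mul (F : ℝ≥0∞) {y t : ℝ} (ht : 0 < t) :
    volume.restrict (Ioc 0 y) {u | F ≤ ENNReal.ofReal (t ^ 2 * u)} =
      ENNReal.ofReal y - F / ENNReal.ofReal (t ^ 2) := by
  have ht2 : 0 < t ^ 2 := pow_pos ht 2
  rw [Measure.restrict_apply (measurableSet_le measurable_const (by fun_prop))]
  by_cases hF : F = ∞
  · subst hF
    simp [ENNReal.top_div]
  lift F to NNReal using hF
  rw [← ENNReal.ofReal_coe_nnreal (p := F), ← ENNReal.ofReal_div_of_pos ht2,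
    ← ENNReal.ofReal_sub _ (by positivity)]
  have h0 : (0 : ℝ) ≤ F / t ^ 2 := by positivity
  have hiff : ∀ u : ℝ, 0 < u →
      (ENNReal.ofReal F ≤ ENNReal.ofReal (t ^ 2 * u) ↔ (F : ℝ) / t ^ 2 ≤ u) := by
    intro u hu
    rw [ENNReal.ofReal_le_ofReal_iff (by positivity), div_le_iff₀ ht2, mul_comm]
  refine le_antisymm ?_ ?_
  · rw [← Real.volume_Icc]
    exact measure_mono fun u hu => ⟨(hiff u hu.2.1).1 hu.1, hu.2.2⟩
  · rw [← Real.volume_Ioc]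
    exact measure_mono fun u hu =>
      ⟨(hiff u (h0.trans_lt hu.1)).2 hu.1.le, h0.trans_lt hu.1, hu.2⟩

lemma volume_sq_mul_lt (F : ℝ≥0∞) {y t : ℝ} (ht : 0 < t) :
    volume.restrict (Ioc 0 y) {u | ENNReal.ofReal (t ^ 2 * u) < F} =
      min (ENNReal.ofReal y) (F / ENNReal.ofReal (t ^ 2)) := by
  have hc : {u | ENNReal.ofReal (t ^ 2 * u) < F} = {u | F ≤ ENNReal.ofReal (t ^ 2 * u)}ᶜ := by
    ext u; simp
  rw [hc, measure_compl (measurableSet_le measurable_const (by fun_prop)) (measure_ne_top _ _),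
    volume_le_sq_mul F ht]
  simp only [Measure.restrict_apply_univ, Real.volume_Ioc, sub_zero]
  rcases le_total (ENNReal.ofReal y) (F / ENNReal.ofReal (t ^ 2)) with h | h
  · rw [min_eq_left h, tsub_eq_zero_of_le h, tsub_zero]
  · rw [min_eq_right h, ENNReal.sub_sub_cancel ENNReal.ofReal_ne_top h]

lemma lintegral_triple_swap {L : Measure ℝ} [SFinite L] {T : Set ℝ} {U : Set ℝ}
    {f : ℝ × ℝ × ℝ → ℝ≥0∞} (hf : Measurable f) :
    ∫⁻ t in T, ∫⁻ u in U, ∫⁻ l, f (t, u, l) ∂L =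
      ∫⁻ l, (∫⁻ t in T, ∫⁻ u in U, f (t, u, l)) ∂L := by
  have h1 : ∀ t, ∫⁻ u in U, ∫⁻ l, f (t, u, l) ∂L = ∫⁻ l, (∫⁻ u in U, f (t, u, l)) ∂L := by
    intro t
    exact lintegral_lintegral_swap (μ := volume.restrict U) (ν := L) (f := fun u l => f (t, u, l))
      (Measurable.aemeasurable (by fun_prop))
  simp_rw [h1]
  refine lintegral_lintegral_swap (μ := volume.restrict T) (ν := L)
    (f := fun t l => ∫⁻ u in U, f (t, u, l))
    (Measurable.aemeasurable ?_)
  exact Measurable.lintegral_prod_right'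
    (f := fun p : (ℝ × ℝ) × ℝ => f (p.1.1, p.2, p.1.2)) (by fun_prop)

/-- Tonelli on the region `F l ≤ t²u`: its slices in `l` have length `F⁻¹(t²u)⁺`, its slices in `u ≤
y` have length `(y - F l/t²)⁺`. -/
lemma psiPosPart_eq {F : ℝ → ℝ≥0∞} (hF : Monotone F) (y : ℝ) :
    psiPosPart F y = ∫⁻ l in Ioi (0 : ℝ), hfun (ENNReal.ofReal y) (F l) := by
  let S : Set (ℝ × ℝ × ℝ) := {p | F p.2.2 ≤ ENNReal.ofReal (p.1 ^ 2 * p.2.1)}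
  have hFm := hF.measurable
  have hS : MeasurableSet S := measurableSet_le (by fun_prop) (by fun_prop)
  have h1 : psiPosPart F y = ∫⁻ t in Ioc (0 : ℝ) 1, ∫⁻ u in Ioc (0 : ℝ) y,
      ∫⁻ l in Ioi (0 : ℝ), S.indicator 1 (t, u, l) := by
    unfold psiPosPart
    refine lintegral_congr fun t => lintegral_congr fun u => ?_
    have hm : MeasurableSet {l | F l ≤ ENNReal.ofReal (t ^ 2 * u)} :=
      measurableSet_le hFm measurable_const
    rw [toENNReal_pinv hF, ← lintegral_indicator_one hm]
    rfl
  rw [h1, lintegral_triple_swap (measurable_one.indicator hS)]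
  refine lintegral_congr fun l => setLIntegral_congr_fun measurableSet_Ioc fun t ht => ?_
  have hm : MeasurableSet {u : ℝ | F l ≤ ENNReal.ofReal (t ^ 2 * u)} :=
    measurableSet_le measurable_const (by fun_prop)
  rw [← volume_le_sq_mul _ ht.1, ← lintegral_indicator_one hm]
  rfl

lemma psiNegPart_eq {F : ℝ → ℝ≥0∞} (hF : Monotone F) (y : ℝ) :
    psiNegPart F y = ∫⁻ l in Iic (0 : ℝ), qfun (ENNReal.ofReal y) (F l) := by
  let S : Set (ℝ × ℝ × ℝ) := {p | ENNReal.ofReal (p.1 ^ 2 * p.2.1) < F p.2.2}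
  have hFm := hF.measurable
  have hS : MeasurableSet S := measurableSet_lt (by fun_prop) (by fun_prop)
  have h1 : psiNegPart F y = ∫⁻ t in Ioc (0 : ℝ) 1, ∫⁻ u in Ioc (0 : ℝ) y,
      ∫⁻ l in Iic (0 : ℝ), S.indicator 1 (t, u, l) := by
    unfold psiNegPart
    refine lintegral_congr fun t => lintegral_congr fun u => ?_
    have hm : MeasurableSet {l | ENNReal.ofReal (t ^ 2 * u) < F l} :=
      measurableSet_lt measurable_const hFm
    rw [toENNReal_neg_pinv hF, ← lintegral_indicator_one hm]
    rfl
  rw [h1, lintegral_triple_swap (measurable_one.indicator hS)]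
  refine lintegral_congr fun l => setLIntegral_congr_fun measurableSet_Ioc fun t ht => ?_
  have hm : MeasurableSet {u : ℝ | ENNReal.ofReal (t ^ 2 * u) < F l} :=
    measurableSet_lt (by fun_prop) measurable_const
  rw [← volume_sq_mul_lt _ ht.1, ← lintegral_indicator_one hm]
  rfl

/-! ### Hilbert–Schmidt norms and scalar spectral measures -/

section Hilbert

variable {H : Type*} [NormedAddCommGroup H] [InnerProductSpace ℂ H]

lemma enorm_sq_eq_tsum_inner {ι : Type*} (b : HilbertBasis ι ℂ H) (f : H) :
    ‖f‖ₑ ^ 2 = ∑' i, ‖inner ℂ (b i) f‖ₑ ^ 2 := by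
  have h := b.hasSum_inner_mul_inner f f
  have h2 : HasSum (fun i => ‖inner ℂ (b i) f‖ ^ 2) (‖f‖ ^ 2) := by
    have h3 := Complex.hasSum_re h
    rw [inner_self_eq_norm_sq_to_K] at h3
    convert h3 using 1
    · ext i
      rw [← inner_conj_symm f (b i), RCLike.conj_mul]
      norm_cast
    · norm_cast
  have h4 := ENNReal.ofReal_tsum_of_nonneg (fun i => by positivity) h2.summable
  rw [h2.tsum_eq] at h4
  simpa [ENNReal.ofReal_pow, ofReal_norm] using h4

variable [CompleteSpace H]

/-- The square `∑ ‖T e_i‖²` of the Hilbert–Schmidt norm of `T`. -/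
def hsSq (T : H →L[ℂ] H) : ℝ≥0∞ :=
  ∑' i, ‖T (stdBasis H i)‖ₑ ^ 2

/-- Both sides sum the squared moduli of all matrix coefficients. The index set may be uncountable,
which is harmless in `ℝ≥0∞`. -/
lemma hsSq_adjoint (T : H →L[ℂ] H) : hsSq (ContinuousLinearMap.adjoint T) = hsSq T := by
  unfold hsSq
  simp_rw [enorm_sq_eq_tsum_inner (stdBasis H)]
  rw [ENNReal.tsum_comm]
  refine tsum_congr fun i => tsum_congr fun j => ?_
  rw [ContinuousLinearMap.adjoint_inner_right, ← inner_conj_symm]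
  simp only [enorm_eq_nnnorm, RCLike.nnnorm_conj]

lemma hsSq_mul_le (S T : H →L[ℂ] H) : hsSq (S * T) ≤ ‖S‖ₑ ^ 2 * hsSq T := by
  unfold hsSq
  rw [← ENNReal.tsum_mul_left]
  refine ENNReal.tsum_le_tsum fun i => ?_
  rw [← mul_pow]
  gcongr
  exact S.le_opENorm _

lemma hsSq_mul_comm {S T : H →L[ℂ] H} (hS : IsSelfAdjoint S) (hT : IsSelfAdjoint T) :
    hsSq (S * T) = hsSq (T * S) := by
  rw [← hsSq_adjoint, ← ContinuousLinearMap.star_eq_adjoint, star_mul, hS.star_eq, hT.star_eq]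

lemma isSelfAdjoint_sqrtOp (P : H →L[ℂ] H) : IsSelfAdjoint (sqrtOp P) :=
  (sqrtOp_isPositive P).isSelfAdjoint

lemma enorm_sqrtOp_sq {P : H →L[ℂ] H} (hP : P.IsPositive) : ‖sqrtOp P‖ₑ ^ 2 = ‖P‖ₑ := by
  have h := CStarRing.norm_star_mul_self (x := sqrtOp P)
  rw [(isSelfAdjoint_sqrtOp P).star_eq, sqrtOp_mul_self hP] at h
  rw [← ofReal_norm, ← ofReal_norm, h, ← ENNReal.ofReal_pow (norm_nonneg _), sq]

lemma sqrtOp_of_isStarProjection {P : H →L[ℂ] H} (hP : IsStarProjection P) : sqrtOp P = P :=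
  CFC.sqrt_unique hP.isIdempotentElem hP.nonneg

lemma posTrace_eq_hsSq_sqrtOp {P : H →L[ℂ] H} (hP : P.IsPositive) :
    posTrace P = hsSq (sqrtOp P) := by
  refine tsum_congr fun i => ?_
  have h1 : P (stdBasis H i) = sqrtOp P (sqrtOp P (stdBasis H i)) :=
    (congrArg (fun T : H →L[ℂ] H => T (stdBasis H i)) (sqrtOp_mul_self hP)).symm
  have h2 := (sqrtOp_isPositive P).isSymmetric (stdBasis H i) (sqrtOp P (stdBasis H i))
  rw [h1]
  have h3 : (inner ℂ (stdBasis H i) (sqrtOp P (sqrtOp P (stdBasis H i)))).re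
      = ‖sqrtOp P (stdBasis H i)‖ ^ 2 := by
    rw [norm_sq_eq_re_inner (𝕜 := ℂ)]
    exact congrArg Complex.re h2.symm
  rw [h3, ENNReal.ofReal_pow (norm_nonneg _), ofReal_norm]

namespace ProjMeasure

variable (E : ProjMeasure H)

lemma inner_proj (f : H) {B : Set ℝ} (hB : MeasurableSet B) :
    (inner ℂ f (E.proj B f)).re = ‖E.proj B f‖ ^ 2 := by
  have hP := E.isStarProjection B hB
  have h1 : E.proj B f = E.proj B (E.proj B f) :=
    (congrArg (fun T : H →L[ℂ] H => T f) hP.isIdempotentElem).symm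
  have h2 := (ContinuousLinearMap.isSelfAdjoint_iff_isSymmetric.1 hP.isSelfAdjoint) f (E.proj B f)
  rw [norm_sq_eq_re_inner (𝕜 := ℂ)]
  exact (congrArg (fun z => (inner ℂ f z).re) h1).trans (congrArg Complex.re h2.symm)

lemma scalar_apply (f : H) {B : Set ℝ} (hB : MeasurableSet B) :
    E.scalar f B = ‖E.proj B f‖ₑ ^ 2 := by
  rw [scalar, Measure.ofMeasurable_apply _ hB, E.inner_proj f hB,
    ENNReal.ofReal_pow (norm_nonneg _), ofReal_norm]

lemma scalar_univ (f : H) : E.scalar f univ = ‖f‖ₑ ^ 2 := by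
  rw [E.scalar_apply f MeasurableSet.univ, E.proj_univ]
  rfl

instance (f : H) : IsFiniteMeasure (E.scalar f) :=
  ⟨by rw [E.scalar_univ]; exact ENNReal.pow_lt_top enorm_lt_top⟩

lemma enorm_sub_proj_sq (f : H) (l : ℝ) :
    ‖f - E.proj (Iio l) f‖ₑ ^ 2 = E.scalar f (Ici l) := by
  have h1 : E.scalar f (Iio l) + E.scalar f (Ici l) = E.scalar f univ := by
    rw [← compl_Iio]
    exact measure_add_measure_compl measurableSet_Iio
  have h2 : ‖f‖ ^ 2 = ‖E.proj (Iio l) f‖ ^ 2 + ‖f - E.proj (Iio l) f‖ ^ 2 := by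
    have h3 := norm_sub_sq (𝕜 := ℂ) f (E.proj (Iio l) f)
    have h4 := E.inner_proj f (measurableSet_Iio (a := l))
    simp only [RCLike.re_to_complex] at h3
    rw [h4] at h3
    linarith
  have h3 : ‖f‖ₑ ^ 2 = ‖E.proj (Iio l) f‖ₑ ^ 2 + ‖f - E.proj (Iio l) f‖ₑ ^ 2 := by
    have := congrArg ENNReal.ofReal h2
    rwa [ENNReal.ofReal_add (by positivity) (by positivity), ENNReal.ofReal_pow (norm_nonneg _),
      ENNReal.ofReal_pow (norm_nonneg _), ENNReal.ofReal_pow (norm_nonneg _), ofReal_norm,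
      ofReal_norm, ofReal_norm] at this
  rw [E.scalar_univ, h3, E.scalar_apply f measurableSet_Iio] at h1
  exact ((ENNReal.add_right_inj (ENNReal.pow_ne_top enorm_ne_top)).1 h1).symm

lemma hsSq_proj_mul_mono (T : H →L[ℂ] H) : Monotone fun l => hsSq (E.proj (Iio l) * T) := by
  intro l l' h
  refine ENNReal.tsum_le_tsum fun i => ?_
  have h1 := E.scalar_apply (T (stdBasis H i)) (measurableSet_Iio (a := l))
  have h2 := E.scalar_apply (T (stdBasis H i)) (measurableSet_Iio (a := l'))
  change ‖E.proj (Iio l) (T (stdBasis H i))‖ₑ ^ 2 ≤ ‖E.proj (Iio l') (T (stdBasis H i))‖ₑ ^ 2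
  rw [← h1, ← h2]
  exact measure_mono (Iio_subset_Iio h)

end ProjMeasure

/-! ### The distribution of the energy of a state -/

/-- The measure `B ↦ τ(ρ^{1/2} E(B) ρ^{1/2})` on `ℝ`. -/
def energyMeasure (A : H →ₗ.[ℂ] H) (ρ : H →L[ℂ] H) : Measure ℝ :=
  Measure.sum fun i => (spectralMeasure A).scalar (sqrtOp ρ (stdBasis H i))

lemma traceFun_eq (A : H →ₗ.[ℂ] H) (ρ : H →L[ℂ] H) (g : ℝ → ℝ≥0∞) :
    traceFun A ρ g = ∫⁻ l, g l ∂(energyMeasure A ρ) :=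
  (lintegral_sum_measure _ _).symm

lemma energyMeasure_univ (A : H →ₗ.[ℂ] H) {ρ : H →L[ℂ] H} (hρ : ρ.IsPositive) :
    energyMeasure A ρ univ = posTrace ρ := by
  rw [energyMeasure, Measure.sum_apply _ MeasurableSet.univ, posTrace_eq_hsSq_sqrtOp hρ]
  exact tsum_congr fun i => ProjMeasure.scalar_univ _ _

lemma isFiniteMeasure_energyMeasure (A : H →ₗ.[ℂ] H) {ρ : H →L[ℂ] H} (hρ : IsState ρ) :
    IsFiniteMeasure (energyMeasure A ρ) :=
  ⟨by rw [energyMeasure_univ A hρ.1]; exact hρ.2⟩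

lemma energyPos_eq (A : H →ₗ.[ℂ] H) (ρ : H →L[ℂ] H) :
    energyPos A ρ = ∫⁻ l in Ioi (0 : ℝ), energyMeasure A ρ (Ici l) := by
  -- The non-strict layer cake here and the strict one for the negative part give `[l, ∞)` and `(-∞,
  -- l)`, complementary sets adapted to `Π_l`.
  rw [energyPos, traceFun_eq, lintegral_eq_lintegral_meas_le (f := fun l : ℝ => max l 0) _
    (Filter.Eventually.of_forall fun l => le_max_right _ _)
    (Measurable.aemeasurable (by fun_prop))]
  refine setLIntegral_congr_fun measurableSet_Ioi fun t ht => ?_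
  congr 1
  ext l
  have : (0 : ℝ) < t := ht
  simp [not_le.2 this]

lemma energyNeg_eq (A : H →ₗ.[ℂ] H) (ρ : H →L[ℂ] H) :
    energyNeg A ρ = ∫⁻ l in Iic (0 : ℝ), energyMeasure A ρ (Iio l) := by
  rw [energyNeg, traceFun_eq, lintegral_eq_lintegral_meas_lt (f := fun l : ℝ => max (-l) 0) _
    (Filter.Eventually.of_forall fun l => le_max_right _ _)
    (Measurable.aemeasurable (by fun_prop))]
  have h1 : ∫⁻ t in Ioi (0 : ℝ), energyMeasure A ρ {l | t < max (-l) 0} =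
      ∫⁻ t in Ioi (0 : ℝ), energyMeasure A ρ (Iio (-t)) := by
    refine setLIntegral_congr_fun measurableSet_Ioi fun t ht => ?_
    congr 1
    ext l
    have : (0 : ℝ) < t := ht
    simp [not_lt.2 this.le, lt_neg]
  rw [h1, ← Measure.restrict_congr_set Iio_ae_eq_Iic, ← lintegral_indicator measurableSet_Ioi,
    ← lintegral_indicator measurableSet_Iio,
    ← lintegral_neg_eq_self (Iio 0 |>.indicator fun l => energyMeasure A ρ (Iio l))]
  refine lintegral_congr fun t => ?_
  by_cases ht : 0 < t
  · rw [indicator_of_mem (mem_Ioi.2 ht), indicator_of_mem (mem_Iio.2 (neg_neg_iff_pos.2 ht))]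
  · rw [indicator_of_notMem (by simpa using ht), indicator_of_notMem (by simpa using ht)]

end Hilbert

/-! ### Radon–Nikodym derivatives with respect to a `σ`-finite measure -/

/-- A measure that is absolutely continuous with respect to a `σ`-finite measure has a density, even
if it is not `s`-finite itself. -/
lemma haveLebesgueDecomposition_of_absolutelyContinuous {X : Type*} [MeasurableSpace X]
    {μ ν : Measure X} [SigmaFinite μ] (h : ν ≪ μ) : ν.HaveLebesgueDecomposition μ := by
  -- Outside the `σ`-finite part, `ν` is infinite on every set that `μ` charges, so it equals `∞ •
  -- μ` there. This covers spectral projections of locally infinite trace.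
  have h1 : ν = ν.restrict (ν.sigmaFiniteSetWRT μ) +
      ∞ • μ.restrict (ν.sigmaFiniteSetWRT μ)ᶜ := by
    rw [← restrict_compl_sigmaFiniteSetWRT h, Measure.restrict_add_restrict_compl
      measurableSet_sigmaFiniteSetWRT]
  rw [h1]
  infer_instance

lemma setLIntegral_rnDeriv_of_absolutelyContinuous {X : Type*} [MeasurableSpace X]
    {μ ν : Measure X} [SigmaFinite μ] (h : ν ≪ μ) {S : Set X} (hS : MeasurableSet S) :
    ∫⁻ x in S, ν.rnDeriv μ x ∂μ = ν S := by
  have := haveLebesgueDecomposition_of_absolutelyContinuous h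
  rw [← withDensity_apply _ hS, Measure.withDensity_rnDeriv_eq _ _ h]

/-! ### Local Hilbert–Schmidt norms and the low/high energy splitting of a state -/

section Density

variable {X V : Type*} [MeasurableSpace X] {μ : Measure X}
  [NormedAddCommGroup V]

/-- The measure `S ↦ ∑ ∫_S ‖g_i(x)‖² dμ(x)` of a family of vectors. -/
def familyMeasure {ι : Type*} (g : ι → Lp V 2 μ) : Measure X :=
  Measure.sum fun i => μ.withDensity fun x => ‖g i x‖ₑ ^ 2

lemma familyMeasure_apply {ι : Type*} (g : ι → Lp V 2 μ) {S : Set X} (hS : MeasurableSet S) :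
    familyMeasure g S = ∑' i, ∫⁻ x in S, ‖g i x‖ₑ ^ 2 ∂μ := by
  rw [familyMeasure, Measure.sum_apply _ hS]
  exact tsum_congr fun i => withDensity_apply _ hS

lemma familyMeasure_absolutelyContinuous {ι : Type*} (g : ι → Lp V 2 μ) :
    familyMeasure g ≪ μ :=
  Measure.absolutelyContinuous_sum_left fun _ => withDensity_absolutelyContinuous _ _

lemma enorm_add_sq_le {s : ℝ} (h0 : 0 < s) (h1 : s < 1) (a b : V) :
    ENNReal.ofReal (1 - s) * ‖a + b‖ₑ ^ 2 ≤ ‖b‖ₑ ^ 2 + ENNReal.ofReal (1 / s - 1) * ‖a‖ₑ ^ 2 := by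
  have e1 : (0 : ℝ) ≤ 1 - s := by linarith
  have e2 : (0 : ℝ) ≤ 1 / s - 1 := by
    rw [sub_nonneg, le_div_iff₀ h0]; linarith
  simp_rw [← ofReal_norm, ← ENNReal.ofReal_pow (norm_nonneg _)]
  rw [← ENNReal.ofReal_mul e1, ← ENNReal.ofReal_mul e2,
    ← ENNReal.ofReal_add (by positivity) (mul_nonneg e2 (by positivity))]
  refine ENNReal.ofReal_le_ofReal ?_
  have h2 : (1 - s) * ‖a + b‖ ^ 2 ≤ (1 - s) * (‖a‖ + ‖b‖) ^ 2 :=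
    mul_le_mul_of_nonneg_left (pow_le_pow_left₀ (norm_nonneg _) (norm_add_le a b) 2) e1
  refine h2.trans (sub_nonneg.1 ?_)
  -- The weights `1 - s` and `1/s - 1` are those that make the defect a perfect square.
  have h3 : ‖b‖ ^ 2 + (1 / s - 1) * ‖a‖ ^ 2 - (1 - s) * (‖a‖ + ‖b‖) ^ 2 =
      ((1 - s) * ‖a‖ - s * ‖b‖) ^ 2 / s := by
    field_simp
    ring
  rw [h3]
  positivity

variable [InnerProductSpace ℂ V] [CompleteSpace V]

lemma nu_eq_familyMeasure (P : Lp V 2 μ →L[ℂ] Lp V 2 μ) :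
    nu P = familyMeasure fun i => sqrtOp P (stdBasis (Lp V 2 μ) i) := by
  ext S hS
  rw [familyMeasure_apply _ hS, nu, Measure.ofMeasurable_apply _ hS, posTrace_sqrt_chi]

lemma nu_absolutelyContinuous (P : Lp V 2 μ →L[ℂ] Lp V 2 μ) : nu P ≪ μ := by
  rw [nu_eq_familyMeasure]
  exact familyMeasure_absolutelyContinuous _

lemma setLIntegral_density [SigmaFinite μ] (P : Lp V 2 μ →L[ℂ] Lp V 2 μ) {S : Set X}
    (hS : MeasurableSet S) : ∫⁻ x in S, density P x ∂μ = nu P S :=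
  setLIntegral_rnDeriv_of_absolutelyContinuous (nu_absolutelyContinuous P) hS

lemma isSelfAdjoint_chi {Ω : Set X} (hΩ : MeasurableSet Ω) :
    IsSelfAdjoint (chi hΩ : Lp V 2 μ →L[ℂ] Lp V 2 μ) := by
  rw [ContinuousLinearMap.isSelfAdjoint_iff_isSymmetric]
  intro f g
  change inner ℂ (chi hΩ f) g = inner ℂ f (chi hΩ g)
  rw [L2.inner_def, L2.inner_def]
  refine integral_congr_ae ?_
  filter_upwards [coeFn_chi hΩ f, coeFn_chi hΩ g] with x hf hg
  rw [hf, hg]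
  by_cases h : x ∈ Ω <;> simp [h]

lemma enorm_sq_eq_lintegral (f : Lp V 2 μ) : ‖f‖ₑ ^ 2 = ∫⁻ x, ‖f x‖ₑ ^ 2 ∂μ := by
  have h := ofReal_inner_chi MeasurableSet.univ f
  have h1 : chi MeasurableSet.univ f = f := by
    refine Lp.ext ?_
    filter_upwards [coeFn_chi MeasurableSet.univ f] with x hx
    simpa using hx
  rw [h1, Measure.restrict_univ] at h
  rw [← h, ← ofReal_norm, ← ENNReal.ofReal_pow (norm_nonneg _), norm_sq_eq_re_inner (𝕜 := ℂ)]
  rfl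

lemma enorm_chi_sq {Ω : Set X} (hΩ : MeasurableSet Ω) (f : Lp V 2 μ) :
    ‖chi hΩ f‖ₑ ^ 2 = ∫⁻ x in Ω, ‖f x‖ₑ ^ 2 ∂μ := by
  rw [enorm_sq_eq_lintegral, ← lintegral_indicator hΩ]
  refine lintegral_congr_ae ?_
  filter_upwards [coeFn_chi hΩ f] with x hx
  rw [hx]
  by_cases h : x ∈ Ω <;> simp [h]

lemma familyMeasure_apply_eq_hsSq (T : Lp V 2 μ →L[ℂ] Lp V 2 μ) {S : Set X}
    (hS : MeasurableSet S) :
    familyMeasure (fun i => T (stdBasis (Lp V 2 μ) i)) S = hsSq (chi hS * T) := by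
  rw [familyMeasure_apply _ hS]
  exact tsum_congr fun i => (enorm_chi_sq hS _).symm

lemma nu_univ {P : Lp V 2 μ →L[ℂ] Lp V 2 μ} (hP : P.IsPositive) : nu P univ = posTrace P := by
  rw [nu_eq_familyMeasure, familyMeasure_apply _ MeasurableSet.univ, posTrace_eq_hsSq_sqrtOp hP,
    Measure.restrict_univ]
  exact tsum_congr fun i => (enorm_sq_eq_lintegral _).symm

variable (A : Lp V 2 μ →ₗ.[ℂ] Lp V 2 μ) (ρ : Lp V 2 μ →L[ℂ] Lp V 2 μ)

lemma isStarProjection_specProj (l : ℝ) : IsStarProjection (specProj A l) :=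
  (spectralMeasure A).isStarProjection _ measurableSet_Iio

lemma nu_specProj_apply (l : ℝ) {S : Set X} (hS : MeasurableSet S) :
    nu (specProj A l) S = hsSq (specProj A l * chi hS) := by
  rw [nu_eq_familyMeasure, sqrtOp_of_isStarProjection (isStarProjection_specProj A l),
    familyMeasure_apply_eq_hsSq _ hS,
    hsSq_mul_comm (isSelfAdjoint_chi hS) (isStarProjection_specProj A l).isSelfAdjoint]

lemma monotone_specF {Ω : Set X} (hΩ : MeasurableSet Ω) : Monotone (specF A Ω) := by
  intro l l' h
  rw [specF, specF, nu_specProj_apply A l hΩ, nu_specProj_apply A l' hΩ]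
  exact (spectralMeasure A).hsSq_proj_mul_mono _ h

lemma monotone_specDensity (x : X) : Monotone (specDensity A x) := fun _ _ h =>
  iSup_mono fun _ => iSup_mono' fun hq => ⟨hq.trans_le h, le_rfl⟩

/-- The measure `S ↦ τ(χ_S ρ^{1/2} Π_{[l, ∞)} ρ^{1/2} χ_S)`. -/
def highMeasure (l : ℝ) : Measure X :=
  familyMeasure fun i => sqrtOp ρ (stdBasis (Lp V 2 μ) i) -
    specProj A l (sqrtOp ρ (stdBasis (Lp V 2 μ) i))

lemma highMeasure_absolutelyContinuous (l : ℝ) : highMeasure A ρ l ≪ μ :=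
  familyMeasure_absolutelyContinuous _

lemma highMeasure_univ (l : ℝ) : highMeasure A ρ l univ = energyMeasure A ρ (Ici l) := by
  rw [highMeasure, familyMeasure_apply _ MeasurableSet.univ, energyMeasure,
    Measure.sum_apply _ measurableSet_Ici, Measure.restrict_univ]
  exact tsum_congr fun i => (enorm_sq_eq_lintegral _).symm.trans
    ((spectralMeasure A).enorm_sub_proj_sq _ l)

/-- Passing to the adjoint puts `ρ^{1/2}` on the left of `Π_l χ_S`, where its operator norm factors
out of the Hilbert–Schmidt norm. This is the only source of `‖ρ‖_∞`. -/
lemma low_le (l : ℝ) {ρ : Lp V 2 μ →L[ℂ] Lp V 2 μ} (hρ : ρ.IsPositive) {S : Set X}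
    (hS : MeasurableSet S) :
    familyMeasure (fun i => (specProj A l * sqrtOp ρ) (stdBasis (Lp V 2 μ) i)) S ≤
      ‖ρ‖ₑ * nu (specProj A l) S := by
  have hc : IsSelfAdjoint (chi hS : Lp V 2 μ →L[ℂ] Lp V 2 μ) := isSelfAdjoint_chi hS
  have h1 : hsSq (chi hS * (specProj A l * sqrtOp ρ)) =
      hsSq (sqrtOp ρ * (specProj A l * chi hS)) := by
    rw [← hsSq_adjoint, ← ContinuousLinearMap.star_eq_adjoint (chi hS * (specProj A l * sqrtOp ρ)),
      star_mul, star_mul,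
      hc.star_eq, (isSelfAdjoint_sqrtOp ρ).star_eq,
      (isStarProjection_specProj A l).isSelfAdjoint.star_eq, mul_assoc]
  rw [familyMeasure_apply_eq_hsSq _ hS, h1, nu_specProj_apply A l hS, ← enorm_sqrtOp_sq hρ]
  exact hsSq_mul_le _ _

lemma nu_le_high_add_low {ρ : Lp V 2 μ →L[ℂ] Lp V 2 μ} (hρ : ρ.IsPositive) (l : ℝ) {s : ℝ}
    (h0 : 0 < s) (h1 : s < 1) {S : Set X} (hS : MeasurableSet S) :
    ENNReal.ofReal (1 - s) * nu ρ S ≤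
      highMeasure A ρ l S + ENNReal.ofReal (1 / s - 1) * (‖ρ‖ₑ * nu (specProj A l) S) := by
  refine le_trans ?_ (add_le_add_right (mul_le_mul_right (low_le A l hρ hS) _) _)
  rw [nu_eq_familyMeasure, highMeasure, familyMeasure_apply _ hS, familyMeasure_apply _ hS,
    familyMeasure_apply _ hS, ← ENNReal.tsum_mul_left, ← ENNReal.tsum_mul_left,
    ← ENNReal.tsum_add]
  refine ENNReal.tsum_le_tsum fun i => ?_
  set f := sqrtOp ρ (stdBasis (Lp V 2 μ) i)
  change _ ≤ _ + _ * ∫⁻ x in S, ‖(specProj A l f) x‖ₑ ^ 2 ∂μ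
  have hm : ∀ g : Lp V 2 μ, AEMeasurable (fun x => ‖g x‖ₑ ^ 2) (μ.restrict S) := fun g =>
    ((Lp.aestronglyMeasurable g).enorm.pow_const 2).restrict
  rw [← lintegral_const_mul'' _ (hm _), ← lintegral_const_mul'' _ (hm _),
    ← lintegral_add_left' (hm _)]
  refine lintegral_mono_ae (ae_restrict_of_ae ?_)
  filter_upwards [Lp.coeFn_sub f (specProj A l f)] with x hx
  -- The splitting is used pointwise in `V`: low and high parts are orthogonal in `L²` but not at a
  -- given `x`, hence the cross term controlled by `s`.
  have h2 := enorm_add_sq_le h0 h1 (specProj A l f x) ((f - specProj A l f : Lp V 2 μ) x)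
  have h3 : specProj A l f x + (f - specProj A l f : Lp V 2 μ) x = f x := by
    rw [hx]; simp
  rwa [h3] at h2

end Density

/-! ### Superadditivity of `ψ` -/

lemma measurable_psiPosPart {α : Type*} [MeasurableSpace α] {y : α → ℝ} (hy : Measurable y)
    {F : α → ℝ → ℝ≥0∞} (hF : Measurable (Function.uncurry F)) (hmono : ∀ a, Monotone (F a)) :
    Measurable fun a => psiPosPart (F a) (y a) := by
  simp_rw [fun a => psiPosPart_eq (hmono a)]
  exact Measurable.lintegral_prod_right'
    (f := fun p : α × ℝ => hfun (ENNReal.ofReal (y p.1)) (Function.uncurry F p))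
    (measurable_hfun.comp (f := fun p : α × ℝ =>
      (ENNReal.ofReal (y p.1), Function.uncurry F p)) (by fun_prop))

lemma measurable_psiNegPart {α : Type*} [MeasurableSpace α] {y : α → ℝ} (hy : Measurable y)
    {F : α → ℝ → ℝ≥0∞} (hF : Measurable (Function.uncurry F)) (hmono : ∀ a, Monotone (F a)) :
    Measurable fun a => psiNegPart (F a) (y a) := by
  simp_rw [fun a => psiNegPart_eq (hmono a)]
  exact Measurable.lintegral_prod_right'
    (f := fun p : α × ℝ => qfun (ENNReal.ofReal (y p.1)) (Function.uncurry F p))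
    (measurable_qfun.comp (f := fun p : α × ℝ =>
      (ENNReal.ofReal (y p.1), Function.uncurry F p)) (by fun_prop))

section Swap

variable {α : Type*} [MeasurableSpace α] {m : Measure α} [SFinite m] {y : α → ℝ}
  {F : α → ℝ → ℝ≥0∞}

lemma lintegral_psiPosPart (hy : Measurable y) (hF : Measurable (Function.uncurry F))
    (hmono : ∀ a, Monotone (F a)) :
    ∫⁻ a, psiPosPart (F a) (y a) ∂m =
      ∫⁻ l in Ioi (0 : ℝ), (∫⁻ a, hfun (ENNReal.ofReal (y a)) (F a l) ∂m) := by
  simp_rw [fun a => psiPosPart_eq (hmono a)]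
  refine lintegral_lintegral_swap (μ := m) (ν := volume.restrict (Ioi 0))
    (f := fun a l => hfun (ENNReal.ofReal (y a)) (F a l)) (Measurable.aemeasurable ?_)
  exact measurable_hfun.comp (f := fun p : α × ℝ =>
    (ENNReal.ofReal (y p.1), Function.uncurry F p)) (by fun_prop)

lemma lintegral_psiNegPart (hy : Measurable y) (hF : Measurable (Function.uncurry F))
    (hmono : ∀ a, Monotone (F a)) :
    ∫⁻ a, psiNegPart (F a) (y a) ∂m =
      ∫⁻ l in Iic (0 : ℝ), (∫⁻ a, qfun (ENNReal.ofReal (y a)) (F a l) ∂m) := by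
  simp_rw [fun a => psiNegPart_eq (hmono a)]
  refine lintegral_lintegral_swap (μ := m) (ν := volume.restrict (Iic 0))
    (f := fun a l => qfun (ENNReal.ofReal (y a)) (F a l)) (Measurable.aemeasurable ?_)
  exact measurable_qfun.comp (f := fun p : α × ℝ =>
    (ENNReal.ofReal (y p.1), Function.uncurry F p)) (by fun_prop)

variable {Y : ℝ} {F₀ : ℝ → ℝ≥0∞}

lemma psiPosPart_le_lintegral (hy : Measurable y) (hF : Measurable (Function.uncurry F))
    (hmono : ∀ a, Monotone (F a)) (hF₀ : Monotone F₀)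
    (hY : ENNReal.ofReal Y = ∫⁻ a, ENNReal.ofReal (y a) ∂m)
    (hle : ∀ l, ∫⁻ a, F a l ∂m ≤ F₀ l) :
    psiPosPart F₀ Y ≤ ∫⁻ a, psiPosPart (F a) (y a) ∂m := by
  rw [psiPosPart_eq hF₀, lintegral_psiPosPart hy hF hmono, hY]
  exact lintegral_mono fun l => hfun_integral_le hy.ennreal_ofReal
    (hF.comp measurable_prodMk_right) (hle l)

lemma lintegral_psiNegPart_le (hy : Measurable y) (hF : Measurable (Function.uncurry F))
    (hmono : ∀ a, Monotone (F a)) (hF₀ : Monotone F₀)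
    (hY : ENNReal.ofReal Y = ∫⁻ a, ENNReal.ofReal (y a) ∂m)
    (hle : ∀ l, ∫⁻ a, F a l ∂m ≤ F₀ l) :
    ∫⁻ a, psiNegPart (F a) (y a) ∂m ≤ psiNegPart F₀ Y := by
  rw [psiNegPart_eq hF₀, lintegral_psiNegPart hy hF hmono, hY]
  exact lintegral_mono fun l => lintegral_qfun_le hy.ennreal_ofReal
    (hF.comp measurable_prodMk_right) (hY ▸ ENNReal.ofReal_ne_top) (hle l)

end Swap

section Density

variable {X V : Type*} [MeasurableSpace X] {μ : Measure X}
  [NormedAddCommGroup V] [InnerProductSpace ℂ V] [CompleteSpace V]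

variable (A : Lp V 2 μ →ₗ.[ℂ] Lp V 2 μ) {ρ : Lp V 2 μ →L[ℂ] Lp V 2 μ}

/-! ### The densities of a state and of the spectral projections -/

lemma measurable_density (P : Lp V 2 μ →L[ℂ] Lp V 2 μ) : Measurable (density P) :=
  Measure.measurable_rnDeriv _ _

lemma measurable_argPt (ρ : Lp V 2 μ →L[ℂ] Lp V 2 μ) : Measurable (argPt ρ) :=
  (measurable_density ρ).ennreal_toReal.div_const _

lemma measurable_specDensity : Measurable (Function.uncurry (specDensity A)) := by
  have h1 : Function.uncurry (specDensity A) = fun p : X × ℝ => ⨆ q : ℚ,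
      {p : X × ℝ | (q : ℝ) < p.2}.indicator (fun p => density (specProj A q) p.1) p := by
    ext p
    refine iSup_congr fun q => ?_
    by_cases h : (q : ℝ) < p.2 <;> simp [h]
  rw [h1]
  refine Measurable.iSup fun q => Measurable.indicator ?_ ?_
  · exact (measurable_density _).comp measurable_fst
  · exact measurableSet_lt measurable_const measurable_snd

lemma nu_ne_top (hρ : IsState ρ) (S : Set X) : nu ρ S ≠ ∞ :=
  ne_top_of_le_ne_top (by rw [nu_univ hρ.1]; exact hρ.2.ne) (measure_mono (subset_univ S))

lemma ofReal_argSet (hρ : IsState ρ) (hρ0 : ρ ≠ 0) (S : Set X) :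
    ENNReal.ofReal (argSet ρ S) = nu ρ S / ‖ρ‖ₑ := by
  rw [argSet, ENNReal.ofReal_div_of_pos (norm_pos_iff.2 hρ0), ENNReal.ofReal_toReal
    (nu_ne_top hρ S), ofReal_norm]

lemma ofReal_argSet_iUnion {ι : Type*} [Countable ι] {Ω : ι → Set X} (hρ : IsState ρ) (hρ0 : ρ ≠ 0)
    (hΩ : ∀ i, MeasurableSet (Ω i))
    (hd : Pairwise (Function.onFun Disjoint Ω)) :
    ENNReal.ofReal (argSet ρ (⋃ i, Ω i)) = ∑' i, ENNReal.ofReal (argSet ρ (Ω i)) := by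
  simp_rw [ofReal_argSet hρ hρ0]
  rw [measure_iUnion hd hΩ]
  simp_rw [div_eq_mul_inv]
  rw [ENNReal.tsum_mul_right]

lemma psiPosPart_iUnion_le {ι : Type*} [Countable ι] {Ω : ι → Set X}
    (hρ : IsState ρ) (hρ0 : ρ ≠ 0) (hΩ : ∀ i, MeasurableSet (Ω i))
    (hd : Pairwise (Function.onFun Disjoint Ω)) :
    psiPosPart (specF A (⋃ i, Ω i)) (argSet ρ (⋃ i, Ω i)) ≤
      ∑' i, psiPosPart (specF A (Ω i)) (argSet ρ (Ω i)) := by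
  -- Sums over blocks are integrals against counting measure, so the integral form of
  -- superadditivity applies.
  let _ : MeasurableSpace ι := ⊤
  rw [← lintegral_count]
  refine psiPosPart_le_lintegral (m := Measure.count) (y := fun i => argSet ρ (Ω i))
    (F := fun i => specF A (Ω i)) measurable_from_top
    (measurable_from_prod_countable_right fun i => (monotone_specF A (hΩ i)).measurable)
    (fun i => monotone_specF A (hΩ i)) (monotone_specF A (MeasurableSet.iUnion hΩ)) ?_ ?_
  · rw [lintegral_count, ofReal_argSet_iUnion hρ hρ0 hΩ hd]
  · intro l
    rw [lintegral_count]
    exact (measure_iUnion hd hΩ).ge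

lemma tsum_psiNegPart_le_iUnion {ι : Type*} [Countable ι] {Ω : ι → Set X}
    (hρ : IsState ρ) (hρ0 : ρ ≠ 0) (hΩ : ∀ i, MeasurableSet (Ω i))
    (hd : Pairwise (Function.onFun Disjoint Ω)) :
    ∑' i, psiNegPart (specF A (Ω i)) (argSet ρ (Ω i)) ≤
      psiNegPart (specF A (⋃ i, Ω i)) (argSet ρ (⋃ i, Ω i)) := by
  let _ : MeasurableSpace ι := ⊤
  rw [← lintegral_count]
  refine lintegral_psiNegPart_le (m := Measure.count) (y := fun i => argSet ρ (Ω i))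
    (F := fun i => specF A (Ω i)) measurable_from_top
    (measurable_from_prod_countable_right fun i => (monotone_specF A (hΩ i)).measurable)
    (fun i => monotone_specF A (hΩ i)) (monotone_specF A (MeasurableSet.iUnion hΩ)) ?_ ?_
  · rw [lintegral_count, ofReal_argSet_iUnion hρ hρ0 hΩ hd]
  · intro l
    rw [lintegral_count]
    exact (measure_iUnion hd hΩ).ge

lemma coe_enorm_mul_sub (ρ : Lp V 2 μ →L[ℂ] Lp V 2 μ) (a b : ℝ≥0∞) :
    ((‖ρ‖ : ℝ) : EReal) * ((a : EReal) - b) =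
      ((‖ρ‖ₑ * a : ℝ≥0∞) : EReal) - ((‖ρ‖ₑ * b : ℝ≥0∞) : EReal) := by
  have h : ((‖ρ‖ₑ : ℝ≥0∞) : EReal) = ((‖ρ‖ : ℝ) : EReal) := by
    rw [← ofReal_norm, EReal.coe_ennreal_ofReal, max_eq_left (norm_nonneg _)]
  rw [EReal.coe_ennreal_mul, EReal.coe_ennreal_mul, h]
  exact EReal.mul_sub_of_nonneg_of_ne_top (EReal.coe_nonneg.2 (norm_nonneg _))
    (EReal.coe_ne_top _)

lemma IsMeasurablePartition.tsum_setLIntegral {ι : Type*} [Countable ι]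
    {Ω : ι → Set X} (hΩ : IsMeasurablePartition Ω) (f : X → ℝ≥0∞) :
    ∑' i, ∫⁻ x in Ω i, f x ∂μ = ∫⁻ x, f x ∂μ := by
  rw [← lintegral_iUnion hΩ.1 hΩ.2.1, hΩ.2.2, Measure.restrict_univ]

variable [SigmaFinite μ]

lemma ofReal_argPt (hρ : IsState ρ) (hρ0 : ρ ≠ 0) :
    ∀ᵐ x ∂μ, ENNReal.ofReal (argPt ρ x) = density ρ x / ‖ρ‖ₑ := by
  have h : ∫⁻ x, density ρ x ∂μ ≠ ∞ := by
    rw [← setLIntegral_univ, setLIntegral_density ρ MeasurableSet.univ]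
    exact nu_ne_top hρ univ
  filter_upwards [ae_lt_top (measurable_density ρ) h] with x hx
  rw [argPt, ENNReal.ofReal_div_of_pos (norm_pos_iff.2 hρ0), ENNReal.ofReal_toReal hx.ne,
    ofReal_norm]

lemma setLIntegral_argPt (hρ : IsState ρ) (hρ0 : ρ ≠ 0) {S : Set X} (hS : MeasurableSet S) :
    ∫⁻ x in S, ENNReal.ofReal (argPt ρ x) ∂μ = nu ρ S / ‖ρ‖ₑ := by
  rw [lintegral_congr_ae (ae_restrict_of_ae (ofReal_argPt hρ hρ0))]
  simp_rw [div_eq_mul_inv]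
  rw [lintegral_mul_const _ (measurable_density ρ), setLIntegral_density ρ hS]

lemma density_specProj_mono {q q' : ℝ} (h : q ≤ q') :
    density (specProj A q) ≤ᵐ[μ] density (specProj A q') := by
  refine ae_le_of_forall_setLIntegral_le_of_sigmaFinite (measurable_density _) fun S hS _ => ?_
  rw [setLIntegral_density _ hS, setLIntegral_density _ hS]
  exact monotone_specF A hS h

/-- Monotone convergence along rationals increasing to `l`. Superadditivity needs only this
inequality, so left continuity of `F_S` plays no role. -/
lemma setLIntegral_specDensity_le {S : Set X} (hS : MeasurableSet S) (l : ℝ) :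
    ∫⁻ x in S, specDensity A x l ∂μ ≤ specF A S l := by
  obtain ⟨u, hu, hul, hut⟩ := Real.exists_seq_rat_strictMono_tendsto l
  have hmono : ∀ᵐ x ∂μ, ∀ q q' : ℚ, q ≤ q' →
      density (specProj A q) x ≤ density (specProj A q') x := by
    refine ae_all_iff.2 fun q => ae_all_iff.2 fun q' => ?_
    by_cases h : q ≤ q'
    · filter_upwards [density_specProj_mono A (show (q : ℝ) ≤ q' by exact_mod_cast h)] with x hx _
      exact hx
    · exact Filter.Eventually.of_forall fun x h' => absurd h' h
  calc ∫⁻ x in S, specDensity A x l ∂μ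
      ≤ ∫⁻ x in S, ⨆ n, density (specProj A (u n)) x ∂μ := by
        refine lintegral_mono_ae (ae_restrict_of_ae ?_)
        filter_upwards [hmono] with x hx
        refine iSup₂_le fun q hq => ?_
        obtain ⟨n, hn⟩ := (hut.eventually (lt_mem_nhds hq)).exists
        exact (hx q (u n) (by exact_mod_cast hn.le)).trans
          (le_iSup (fun n => density (specProj A (u n)) x) n)
    _ = ⨆ n, ∫⁻ x in S, density (specProj A (u n)) x ∂μ := by
        refine lintegral_iSup_ae (fun n => measurable_density _) fun n => ae_restrict_of_ae ?_
        filter_upwards [hmono] with x hx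
        exact hx _ _ (hu n.lt_succ_self).le
    _ ≤ specF A S l := iSup_le fun n => by
        rw [setLIntegral_density _ hS]
        exact monotone_specF A hS (hul n).le

lemma hfun_argPt_le (hρ : IsState ρ) (hρ0 : ρ ≠ 0) (l : ℝ) :
    ∀ᵐ x ∂μ, hfun (ENNReal.ofReal (argPt ρ x)) (density (specProj A l) x) ≤
      (highMeasure A ρ l).rnDeriv μ x / ‖ρ‖ₑ := by
  have hR0 : ‖ρ‖ₑ ≠ 0 := enorm_ne_zero.2 hρ0
  have hRt : ‖ρ‖ₑ ≠ ∞ := enorm_ne_top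
  have key : ∀ᵐ x ∂μ, ∀ s : ℚ, 0 < s → s < 1 →
      ENNReal.ofReal (1 - s) * density ρ x ≤ (highMeasure A ρ l).rnDeriv μ x +
        ENNReal.ofReal (1 / s - 1) * (‖ρ‖ₑ * density (specProj A l) x) := by
    refine ae_all_iff.2 fun s => ?_
    by_cases hs : 0 < s ∧ s < 1
    swap
    · exact Filter.Eventually.of_forall fun x h0 h1 => absurd ⟨h0, h1⟩ hs
    have h : (fun x => ENNReal.ofReal (1 - s) * density ρ x) ≤ᵐ[μ]
        fun x => (highMeasure A ρ l).rnDeriv μ x +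
          ENNReal.ofReal (1 / s - 1) * (‖ρ‖ₑ * density (specProj A l) x) := by
      -- For fixed `s` the claim is linear in the densities, so testing it on measurable sets
      -- suffices.
      refine ae_le_of_forall_setLIntegral_le_of_sigmaFinite
        ((measurable_density ρ).const_mul _) fun S hS _ => ?_
      rw [lintegral_const_mul _ (measurable_density ρ), setLIntegral_density ρ hS,
        lintegral_add_left (Measure.measurable_rnDeriv _ _),
        lintegral_const_mul _ ((measurable_density _).const_mul _),
        lintegral_const_mul _ (measurable_density _), setLIntegral_density _ hS,
        setLIntegral_rnDeriv_of_absolutelyContinuous (highMeasure_absolutelyContinuous A ρ l) hS]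
      exact nu_le_high_add_low A hρ.1 l (by exact_mod_cast hs.1) (by exact_mod_cast hs.2) hS
    filter_upwards [h] with x hx _ _
    exact hx
  filter_upwards [key, ofReal_argPt hρ hρ0] with x hx hxy
  refine hfun_le_of_forall_rat ENNReal.ofReal_ne_top fun s h0 h1 => ?_
  rw [hxy]
  have h := ENNReal.div_le_div_right (hx s h0 h1) ‖ρ‖ₑ
  rwa [mul_div_assoc, ENNReal.add_div, mul_div_assoc, mul_comm ‖ρ‖ₑ,
    ENNReal.mul_div_cancel_right hR0 hRt] at h

/-- The left-continuous density at `l` dominates `Dν_{Π_q}` for rational `q < l`, and `h` decreases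
in `F`, so the bound holds with `m([q, ∞))`. Letting `q` increase to `l` uses continuity from above
of the finite measure `m`. -/
lemma mul_lintegral_hfun_le (hρ : IsState ρ) (hρ0 : ρ ≠ 0) (l : ℝ) :
    ‖ρ‖ₑ * ∫⁻ x, hfun (ENNReal.ofReal (argPt ρ x)) (specDensity A x l) ∂μ ≤
      energyMeasure A ρ (Ici l) := by
  have hfinite := isFiniteMeasure_energyMeasure A hρ
  obtain ⟨u, hu, hul, hut⟩ := Real.exists_seq_rat_strictMono_tendsto l
  have hI : Ici l = ⋂ n, Ici (u n : ℝ) := by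
    ext z
    simp only [mem_Ici, mem_iInter]
    exact ⟨fun h n => (hul n).le.trans h, fun h => le_of_tendsto' hut h⟩
  have hlim : Filter.Tendsto (fun n => energyMeasure A ρ (Ici (u n : ℝ))) Filter.atTop
      (nhds (energyMeasure A ρ (Ici l))) := by
    rw [hI]
    refine tendsto_measure_iInter_atTop (fun n => measurableSet_Ici.nullMeasurableSet) ?_
      ⟨0, measure_ne_top _ _⟩
    exact fun n k h => Ici_subset_Ici.2 (by exact_mod_cast hu.monotone h)
  refine ge_of_tendsto' hlim fun n => ?_
  rw [← highMeasure_univ, ← setLIntegral_rnDeriv_of_absolutelyContinuous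
    (highMeasure_absolutelyContinuous A ρ (u n)) MeasurableSet.univ, setLIntegral_univ]
  refine ENNReal.mul_le_of_le_div' ?_
  rw [div_eq_mul_inv, ← lintegral_mul_const _ (Measure.measurable_rnDeriv _ _)]
  refine lintegral_mono_ae ?_
  filter_upwards [hfun_argPt_le A hρ hρ0 (u n)] with x hx
  refine (hfun_anti ?_).trans hx
  exact le_iSup₂ (f := fun (q : ℚ) (_ : (q : ℝ) < l) => density (specProj A q) x) (u n) (hul n)

/-- Both `m([l, ∞)) + m((-∞, l))` and `‖ρ‖ (∫ h + ∫ q)` equal `τ(ρ)`, so the upper bound on `h`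
becomes a lower bound on `q`. -/
lemma le_mul_lintegral_qfun (hρ : IsState ρ) (hρ0 : ρ ≠ 0) (l : ℝ) :
    energyMeasure A ρ (Iio l) ≤
      ‖ρ‖ₑ * ∫⁻ x, qfun (ENNReal.ofReal (argPt ρ x)) (specDensity A x l) ∂μ := by
  have hfinite := isFiniteMeasure_energyMeasure A hρ
  have h1 := mul_lintegral_hfun_le A hρ hρ0 l
  have h2 : energyMeasure A ρ (Ici l) + energyMeasure A ρ (Iio l) = nu ρ univ := by
    rw [add_comm, ← compl_Iio, measure_add_measure_compl measurableSet_Iio,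
      energyMeasure_univ A hρ.1, nu_univ hρ.1]
  have h3 : ‖ρ‖ₑ * ∫⁻ x, ENNReal.ofReal (argPt ρ x) ∂μ = nu ρ univ := by
    rw [← setLIntegral_univ, setLIntegral_argPt hρ hρ0 MeasurableSet.univ,
      ENNReal.mul_div_cancel (enorm_ne_zero.2 hρ0) enorm_ne_top]
  have hm : Measurable fun x => hfun (ENNReal.ofReal (argPt ρ x)) (specDensity A x l) :=
    measurable_hfun.comp ((measurable_argPt ρ).ennreal_ofReal.prodMk
      ((measurable_specDensity A).comp measurable_prodMk_right))
  have h4 : ‖ρ‖ₑ * ∫⁻ x, hfun (ENNReal.ofReal (argPt ρ x)) (specDensity A x l) ∂μ +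
      ‖ρ‖ₑ * ∫⁻ x, qfun (ENNReal.ofReal (argPt ρ x)) (specDensity A x l) ∂μ = nu ρ univ := by
    rw [← mul_add, ← lintegral_add_left hm, ← h3]
    simp_rw [hfun_add_qfun]
  refine (ENNReal.add_le_add_iff_left (measure_ne_top (energyMeasure A ρ) (Ici l))).1 ?_
  rw [h2, ← h4]
  exact add_le_add h1 le_rfl

/-! ### Comparison of the partition quantity, the continuous quantity and the energy -/

lemma mul_lintegral_psiPosPart_le (hρ : IsState ρ) (hρ0 : ρ ≠ 0) :
    ‖ρ‖ₑ * ∫⁻ x, psiPosPart (specDensity A x) (argPt ρ x) ∂μ ≤ energyPos A ρ := by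
  rw [lintegral_psiPosPart (measurable_argPt ρ) (measurable_specDensity A)
    (monotone_specDensity A), energyPos_eq, ← lintegral_const_mul' _ _ enorm_ne_top]
  exact lintegral_mono fun l => mul_lintegral_hfun_le A hρ hρ0 l

lemma le_mul_lintegral_psiNegPart (hρ : IsState ρ) (hρ0 : ρ ≠ 0) :
    energyNeg A ρ ≤ ‖ρ‖ₑ * ∫⁻ x, psiNegPart (specDensity A x) (argPt ρ x) ∂μ := by
  rw [lintegral_psiNegPart (measurable_argPt ρ) (measurable_specDensity A)
    (monotone_specDensity A), energyNeg_eq, ← lintegral_const_mul' _ _ enorm_ne_top]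
  exact lintegral_mono fun l => le_mul_lintegral_qfun A hρ hρ0 l

lemma lintegral_psiPosPart_ne_top (hρ : IsState ρ) (hρ0 : ρ ≠ 0) (hE : energyPos A ρ < ∞) :
    ∫⁻ x, psiPosPart (specDensity A x) (argPt ρ x) ∂μ ≠ ∞ := by
  intro h
  have := mul_lintegral_psiPosPart_le A hρ hρ0
  rw [h, ENNReal.mul_top (enorm_ne_zero.2 hρ0)] at this
  exact hE.not_ge this

lemma ae_psiPosPart_lt_top (hρ : IsState ρ) (hρ0 : ρ ≠ 0) (hE : energyPos A ρ < ∞) :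
    ∀ᵐ x ∂μ, psiPosPart (specDensity A x) (argPt ρ x) < ∞ :=
  ae_lt_top (measurable_psiPosPart (measurable_argPt ρ) (measurable_specDensity A)
    (monotone_specDensity A)) (lintegral_psiPosPart_ne_top A hρ hρ0 hE)

lemma psiPt_ae_eq (hρ : IsState ρ) (hρ0 : ρ ≠ 0) (hE : energyPos A ρ < ∞) :
    psiPt A ρ =ᵐ[μ] fun x => (psiPosPart (specDensity A x) (argPt ρ x) : EReal) -
      (psiNegPart (specDensity A x) (argPt ρ x) : EReal) :=
  (ae_psiPosPart_lt_top A hρ hρ0 hE).mono fun _ hx => psi_eq hx.ne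

lemma aemeasurable_psiPt (hρ : IsState ρ) (hρ0 : ρ ≠ 0) (hE : energyPos A ρ < ∞) :
    AEMeasurable (psiPt A ρ) μ := by
  refine ⟨_, ?_, psiPt_ae_eq A hρ hρ0 hE⟩
  simp_rw [sub_eq_add_neg]
  exact (measurable_psiPosPart (measurable_argPt ρ) (measurable_specDensity A)
      (monotone_specDensity A)).coe_ereal_ennreal.add
    (measurable_psiNegPart (measurable_argPt ρ) (measurable_specDensity A)
      (monotone_specDensity A)).coe_ereal_ennreal.neg

lemma lintegral_psiPt_lt_top (hρ : IsState ρ) (hρ0 : ρ ≠ 0) (hE : energyPos A ρ < ∞) :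
    ∫⁻ x, (psiPt A ρ x).toENNReal ∂μ < ∞ := by
  refine lt_of_le_of_lt (lintegral_mono_ae ?_)
    (lintegral_psiPosPart_ne_top A hρ hρ0 hE).lt_top
  filter_upwards [psiPt_ae_eq A hρ hρ0 hE] with x hx
  rw [hx, toENNReal_coe_sub]
  exact tsub_le_self

lemma continuousH_eq (hρ : IsState ρ) (hρ0 : ρ ≠ 0) (hE : energyPos A ρ < ∞) :
    continuousH A ρ =
      ((‖ρ‖ₑ * ∫⁻ x, psiPosPart (specDensity A x) (argPt ρ x) ∂μ : ℝ≥0∞) : EReal) -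
      ((‖ρ‖ₑ * ∫⁻ x, psiNegPart (specDensity A x) (argPt ρ x) ∂μ : ℝ≥0∞) : EReal) := by
  rw [continuousH, eint_congr (psiPt_ae_eq A hρ hρ0 hE), eint_coe_sub
    (measurable_psiPosPart (measurable_argPt ρ) (measurable_specDensity A)
      (monotone_specDensity A)).aemeasurable
    (measurable_psiNegPart (measurable_argPt ρ) (measurable_specDensity A)
      (monotone_specDensity A)).aemeasurable
    (lintegral_psiPosPart_ne_top A hρ hρ0 hE), coe_enorm_mul_sub]

theorem continuousH_le_energy (hρ : IsState ρ) (hρ0 : ρ ≠ 0) (hE : energyPos A ρ < ∞) :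
    continuousH A ρ ≤ energy A ρ := by
  rw [continuousH_eq A hρ hρ0 hE]
  exact EReal.sub_le_sub
    (EReal.coe_ennreal_le_coe_ennreal_iff.2 (mul_lintegral_psiPosPart_le A hρ hρ0))
    (EReal.coe_ennreal_le_coe_ennreal_iff.2 (le_mul_lintegral_psiNegPart A hρ hρ0))

lemma psiPosPart_specF_le (hρ : IsState ρ) (hρ0 : ρ ≠ 0) {S : Set X} (hS : MeasurableSet S) :
    psiPosPart (specF A S) (argSet ρ S) ≤
      ∫⁻ x in S, psiPosPart (specDensity A x) (argPt ρ x) ∂μ :=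
  psiPosPart_le_lintegral (measurable_argPt ρ) (measurable_specDensity A)
    (monotone_specDensity A) (monotone_specF A hS)
    (by rw [ofReal_argSet hρ hρ0, setLIntegral_argPt hρ hρ0 hS])
    (setLIntegral_specDensity_le A hS)

lemma setLIntegral_psiNegPart_le (hρ : IsState ρ) (hρ0 : ρ ≠ 0) {S : Set X}
    (hS : MeasurableSet S) :
    ∫⁻ x in S, psiNegPart (specDensity A x) (argPt ρ x) ∂μ ≤
      psiNegPart (specF A S) (argSet ρ S) :=
  lintegral_psiNegPart_le (measurable_argPt ρ) (measurable_specDensity A)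
    (monotone_specDensity A) (monotone_specF A hS)
    (by rw [ofReal_argSet hρ hρ0, setLIntegral_argPt hρ hρ0 hS])
    (setLIntegral_specDensity_le A hS)

lemma eq_iUnion_fiber {ι κ : Type*} {Ω : ι → Set X} {Ω' : κ → Set X}
    (hΩ : IsMeasurablePartition Ω) (hΩ' : IsMeasurablePartition Ω') {c : κ → ι}
    (hc : ∀ j, Ω' j ⊆ Ω (c j)) (i : ι) :
    Ω i = ⋃ j : {j // c j = i}, Ω' j := by
  ext x
  simp only [mem_iUnion]
  constructor
  · intro hx
    obtain ⟨j, hj⟩ := mem_iUnion.1 (hΩ'.2.2 ▸ mem_univ x : x ∈ ⋃ j, Ω' j)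
    refine ⟨⟨j, ?_⟩, hj⟩
    by_contra hne
    -- Only nonempty blocks determine their parent; an empty one may be assigned to any `i` without
    -- changing the union.
    exact disjoint_left.1 (hΩ.2.1 hne) (hc j hj) hx
  · rintro ⟨⟨j, rfl⟩, hj⟩
    exact hc j hj

lemma tsum_fiber {ι κ : Type*} (c : κ → ι) (f : κ → ℝ≥0∞) :
    ∑' i, ∑' j : {j // c j = i}, f j = ∑' j, f j := by
  rw [← ENNReal.tsum_sigma fun i (j : {j // c j = i}) => f j]
  exact (Equiv.sigmaFiberEquiv c).tsum_eq f

section Partition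

variable {ι : Type*} [Countable ι] {Ω : ι → Set X}

lemma tsum_psiPosPart_le (hρ : IsState ρ) (hρ0 : ρ ≠ 0) (hΩ : IsMeasurablePartition Ω) :
    ∑' i, psiPosPart (specF A (Ω i)) (argSet ρ (Ω i)) ≤
      ∫⁻ x, psiPosPart (specDensity A x) (argPt ρ x) ∂μ := by
  rw [← hΩ.tsum_setLIntegral]
  exact ENNReal.tsum_le_tsum fun i => psiPosPart_specF_le A hρ hρ0 (hΩ.1 i)

lemma le_tsum_psiNegPart (hρ : IsState ρ) (hρ0 : ρ ≠ 0) (hΩ : IsMeasurablePartition Ω) :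
    ∫⁻ x, psiNegPart (specDensity A x) (argPt ρ x) ∂μ ≤
      ∑' i, psiNegPart (specF A (Ω i)) (argSet ρ (Ω i)) := by
  rw [← hΩ.tsum_setLIntegral]
  exact ENNReal.tsum_le_tsum fun i => setLIntegral_psiNegPart_le A hρ hρ0 (hΩ.1 i)

lemma tsum_psiPosPart_ne_top (hρ : IsState ρ) (hρ0 : ρ ≠ 0) (hE : energyPos A ρ < ∞)
    (hΩ : IsMeasurablePartition Ω) :
    ∑' i, psiPosPart (specF A (Ω i)) (argSet ρ (Ω i)) ≠ ∞ :=
  ne_top_of_le_ne_top (lintegral_psiPosPart_ne_top A hρ hρ0 hE) (tsum_psiPosPart_le A hρ hρ0 hΩ)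

lemma psiPosPart_specF_lt_top (hρ : IsState ρ) (hρ0 : ρ ≠ 0) (hE : energyPos A ρ < ∞)
    (hΩ : IsMeasurablePartition Ω) (i : ι) :
    psiPosPart (specF A (Ω i)) (argSet ρ (Ω i)) < ∞ :=
  (ENNReal.ne_top_of_tsum_ne_top (tsum_psiPosPart_ne_top A hρ hρ0 hE hΩ) i).lt_top

lemma psiSet_eq (hρ : IsState ρ) (hρ0 : ρ ≠ 0) (hE : energyPos A ρ < ∞)
    (hΩ : IsMeasurablePartition Ω) (i : ι) :
    psiSet A ρ (Ω i) = (psiPosPart (specF A (Ω i)) (argSet ρ (Ω i)) : EReal) -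
      (psiNegPart (specF A (Ω i)) (argSet ρ (Ω i)) : EReal) :=
  psi_eq (psiPosPart_specF_lt_top A hρ hρ0 hE hΩ i).ne

lemma tsum_psiSet_lt_top (hρ : IsState ρ) (hρ0 : ρ ≠ 0) (hE : energyPos A ρ < ∞)
    (hΩ : IsMeasurablePartition Ω) : ∑' i, (psiSet A ρ (Ω i)).toENNReal < ∞ := by
  refine lt_of_le_of_lt (ENNReal.tsum_le_tsum fun i => ?_)
    (tsum_psiPosPart_ne_top A hρ hρ0 hE hΩ).lt_top
  rw [psiSet_eq A hρ hρ0 hE hΩ, toENNReal_coe_sub]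
  exact tsub_le_self

lemma partitionH_eq (hρ : IsState ρ) (hρ0 : ρ ≠ 0) (hE : energyPos A ρ < ∞)
    (hΩ : IsMeasurablePartition Ω) :
    partitionH A ρ Ω =
      ((‖ρ‖ₑ * ∑' i, psiPosPart (specF A (Ω i)) (argSet ρ (Ω i)) : ℝ≥0∞) : EReal) -
      ((‖ρ‖ₑ * ∑' i, psiNegPart (specF A (Ω i)) (argSet ρ (Ω i)) : ℝ≥0∞) : EReal) := by
  rw [partitionH]
  simp_rw [psiSet_eq A hρ hρ0 hE hΩ]
  rw [esum_coe_sub (tsum_psiPosPart_ne_top A hρ hρ0 hE hΩ), coe_enorm_mul_sub]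

theorem partitionH_le_continuousH (hρ : IsState ρ) (hρ0 : ρ ≠ 0) (hE : energyPos A ρ < ∞)
    (hΩ : IsMeasurablePartition Ω) : partitionH A ρ Ω ≤ continuousH A ρ := by
  rw [partitionH_eq A hρ hρ0 hE hΩ, continuousH_eq A hρ hρ0 hE]
  exact EReal.sub_le_sub
    (EReal.coe_ennreal_le_coe_ennreal_iff.2 (mul_le_mul_right (tsum_psiPosPart_le A hρ hρ0 hΩ) _))
    (EReal.coe_ennreal_le_coe_ennreal_iff.2 (mul_le_mul_right (le_tsum_psiNegPart A hρ hρ0 hΩ) _))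

/-! ### Monotonicity under refinement -/

theorem partitionH_mono {κ : Type*} [Countable κ] {Ω' : κ → Set X} (hρ : IsState ρ) (hρ0 : ρ ≠ 0)
    (hE : energyPos A ρ < ∞) (hΩ : IsMeasurablePartition Ω) (hΩ' : IsMeasurablePartition Ω')
    (hfin : IsFiner Ω' Ω) : partitionH A ρ Ω ≤ partitionH A ρ Ω' := by
  choose c hc using hfin
  rw [partitionH_eq A hρ hρ0 hE hΩ, partitionH_eq A hρ hρ0 hE hΩ']
  have hd : ∀ i, Pairwise (Function.onFun Disjoint fun j : {j // c j = i} => Ω' j) :=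
    fun i j k hjk => hΩ'.2.1 (Subtype.coe_injective.ne hjk)
  refine EReal.sub_le_sub (EReal.coe_ennreal_le_coe_ennreal_iff.2 (mul_le_mul_right ?_ _))
    (EReal.coe_ennreal_le_coe_ennreal_iff.2 (mul_le_mul_right ?_ _))
  -- The fine blocks are grouped by parent, and superadditivity is applied inside each parent.
  · rw [← tsum_fiber c]
    refine ENNReal.tsum_le_tsum fun i => ?_
    rw [eq_iUnion_fiber hΩ hΩ' hc i]
    exact psiPosPart_iUnion_le A hρ hρ0 (fun j => hΩ'.1 j) (hd i)
  · rw [← tsum_fiber c]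
    refine ENNReal.tsum_le_tsum fun i => ?_
    rw [eq_iUnion_fiber hΩ hΩ' hc i]
    exact tsum_psiNegPart_le_iUnion A hρ hρ0 (fun j => hΩ'.1 j) (hd i)

end Partition

end Density

end BalancedLT

end

theorem mainTheorem1
    {X : Type*} [MeasurableSpace X] (μ : MeasureTheory.Measure X) [MeasureTheory.SigmaFinite μ]
    {V : Type*} [NormedAddCommGroup V] [InnerProductSpace ℂ V] [CompleteSpace V]
    [TopologicalSpace.SeparableSpace V]
    (A : Lp V 2 μ →ₗ.[ℂ] Lp V 2 μ) (hA : IsSelfAdjoint A)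
    (ρ : Lp V 2 μ →L[ℂ] Lp V 2 μ) (hρ : BalancedLT.IsState ρ) (hρ0 : ρ ≠ 0)
    (hE : BalancedLT.energyPos A ρ < ∞)
    {ι : Type*} [Countable ι] (Ω : ι → Set X) (hΩ : BalancedLT.IsMeasurablePartition Ω) :
    -- the sum and the integrals in the partition quantity have a finite positive part
    ((∀ i, BalancedLT.psiPosPart (BalancedLT.specF A (Ω i)) (BalancedLT.argSet ρ (Ω i)) < ∞) ∧
      ∑' i, (BalancedLT.psiSet A ρ (Ω i)).toENNReal < ∞) ∧
    -- the integrals in the continuous quantity have a finite positive part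
    ((∀ᵐ x ∂μ, BalancedLT.psiPosPart (BalancedLT.specDensity A x) (BalancedLT.argPt ρ x) < ∞) ∧
      AEMeasurable (BalancedLT.psiPt A ρ) μ ∧
      ∫⁻ x, (BalancedLT.psiPt A ρ x).toENNReal ∂μ < ∞) ∧
    -- the balanced inequalities
    (BalancedLT.partitionH A ρ Ω ≤ BalancedLT.continuousH A ρ ∧
      BalancedLT.continuousH A ρ ≤ BalancedLT.energy A ρ) ∧
    -- monotonicity under refinement
    (∀ {κ : Type*} [Countable κ] (Ω' : κ → Set X), BalancedLT.IsMeasurablePartition Ω' →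
      BalancedLT.IsFiner Ω' Ω → BalancedLT.partitionH A ρ Ω ≤ BalancedLT.partitionH A ρ Ω') := by
  exact ⟨⟨BalancedLT.psiPosPart_specF_lt_top A hρ hρ0 hE hΩ,
      BalancedLT.tsum_psiSet_lt_top A hρ hρ0 hE hΩ⟩,
    ⟨BalancedLT.ae_psiPosPart_lt_top A hρ hρ0 hE, BalancedLT.aemeasurable_psiPt A hρ hρ0 hE,
      BalancedLT.lintegral_psiPt_lt_top A hρ hρ0 hE⟩,
    ⟨BalancedLT.partitionH_le_continuousH A hρ hρ0 hE hΩ,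
      BalancedLT.continuousH_le_energy A hρ hρ0 hE⟩,
    fun _ hΩ' hfin => BalancedLT.partitionH_mono A hρ hρ0 hE hΩ hΩ' hfin⟩
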